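/- **Strings.** Let the string alphabet consist of the letters $z\in\{a,b,c,d\}$, the barred letters $\bar z$, and the brackets $\langle,\rangle$. For a letter $z$ let $Z=\{z\langle^k\bar z^k\rangle^k\mid k\ge 0\}$, and let $\mathsf{CSD}_s=\{A^nB^mC^nD^m\mid n,m\ge 1\}$ be the set of all concatenations of $n$ blocks from $A$, $m$ from $B$, $n$ from $C$ and $m$ from $D$ (the numbers $k$ are independent for different blocks). Let $\mathsf{Sep}=\{a/c,c/a,b/d,d/b\}$. **The relation.** Let $\mathsf{CSD}$ be a relation between strings and finite directed edge-labelled multigraphs which relates exactly the strings of $\mathsf{CSD}_s$ to some graph, and in which every graph related to $s$ has, for each of the eight symbols $z\in\{a,b,c,d,\bar a,\bar b,\bar c,\bar d\}$, exactly as many $z$-edges as $s$ has $z$-tokens. **The grammar.** Let $G$ be a linear monadic context-free tree grammar (nonterminals of rank $\le 1$, the variable occurs at most once on the right-hand side of a rule) over a finite ranked signature $\Delta$, whose symbols of rank $0$ are labelled by a token or by the empty string. Write $\mathrm{yd}(t)$ for the string of leaf labels of a tree $t$ from left to right; for a context $C$ (a tree with exactly one hole), $\mathrm{yd}(C)$ is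 the string to the left of the hole followed by the string to its right. Let $k\in\mathbb N_0$, let $\mathrm{HR}_k$ be the algebra of s-graphs with $k$ source names (constants, parallel composition, renaming and forgetting of sources), and let $h$ be a linear nondeleting tree homomorphism from trees over $\Delta$ to terms over $\mathrm{HR}_k$. Let $\mathrm{graph}(t)=[\![h(t)]\!]$; the graph generated by a context is obtained by evaluating it with the empty graph in the hole. Assume $$\mathsf{CSD}=\mathrm{REL}(G,h,\mathrm{HR}_k)=\{(\mathrm{yd}(t),\mathrm{graph}(t))\mid t\in L(G)\},$$ graphs being taken up to isomorphism and without their source names. Put $\mathbf T=L(G)$. **Pumping height.** Leaves have height $1$ and the hole of a context has height $0$. A number $p$ is a pumping height of $\mathbf T$ if every $t\in\mathbf T$ of height $>p$ can be written $t=C_1[C_2[C_3[C_4[t_5]]]]$ with $\mathrm{height}(C_2[C_3[C_4]])\le p$, $\mathrm{height}(C_2)+\mathrm{height}(C_4)>0$ and $C_1[v^i[t_5]]\in\mathbf T$ for all $i\ge 0$, where $v^0=C_3$ and $v^{i+1}=C_2[v^i[C_4]]$. **Separation.** For $x/y\in\mathsf{Sep}$ and $l\in\mathbb N_0$, an $x,y,l$-separation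 of a tree $t$ is a decomposition $t=D_x[D_0[t_y]]$ into contexts $D_x,D_0$ and a tree $t_y$ such that $\mathrm{yd}(D_x)$ contains no $y$, $\mathrm{yd}(D_0)$ contains at most $l$ occurrences of $x$, and $\mathrm{yd}(t_y)$ contains no $x$. It is minimal if $\mathrm{height}(D_0)$ is minimal among all $x,y,l$-separations of $t$. The tree $t$ is $x,y,l$-separated if it has an $x,y,l$-separation. It is $x,y,l$-asynchronous if it has a minimal $x,y,l$-separation $t=D_x[D_0[t_y]]$ such that $t_0=D_0[t_y]$ satisfies $$e^{t_0}_{\bar x}\le n^t_x\,l+m^t_{\bar x}(l+1),\qquad e^{t_0}_{\bar y}\ge n^t_{\bar y}-n^t_x\,l-m^t_{\bar y},$$ where $e^{t_0}_z$ is the number of $z$-edges of $\mathrm{graph}(t_0)$, $n^t_z$ is the number of $z$-tokens in $\mathrm{yd}(t)$, and $m^t_z$ is the maximal length of a contiguous substring of $\mathrm{yd}(t)$ consisting only of $z$-tokens. **Lemma 8.** $\mathbf T$ has a pumping height. Let $p$ be any pumping height of $\mathbf T$. There is a number $l_0$ such that every context over $\Delta$ of height at most $p$ generates at most $l_0$ string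 tokens and at most $l_0$ edges; and for every such number $l_0$ (in particular for the least one), for all $x/y\in\mathsf{Sep}$ and all $t\in\mathbf T$: if $t$ is $x,y,l_0$-separated, then $t$ is $x,y,l_0$-asynchronous. -/

import Mathlib

namespace SemCap

/-! ## Tokens and strings -/

/-- The four core letters. -/
inductive Letter where
  | a | b | c | d
  deriving DecidableEq

/-- The eight symbols `z` and `z̄`, for a core letter `z`.  They occur both as tokens of strings and
as edge labels of graphs. -/
inductive Sym where
  | core (z : Letter)
  | bar (z : Letter)
  deriving DecidableEq

/-- The string alphabet: the eight symbols and the two brackets `⟨` and `⟩`. -/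
inductive Token where
  | sym (s : Sym)
  | lbr
  | rbr
  deriving DecidableEq

/-- The token `z`. -/
abbrev Token.core (z : Letter) : Token := .sym (.core z)

/-- The token `z̄`. -/
abbrev Token.bar (z : Letter) : Token := .sym (.bar z)

/-- `Sep x y` means `x/y ∈ Sep = {a/c, c/a, b/d, d/b}`. -/
inductive Sep : Letter → Letter → Prop
  | ac : Sep .a .c
  | ca : Sep .c .a
  | bd : Sep .b .d
  | db : Sep .d .b

/-- The length of a longest contiguous substring of `s` consisting only of `z`-tokens. -/
noncomputable def maxRun (z : Token) (s : List Token) : ℕ :=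
  sSup {n : ℕ | List.replicate n z <:+: s}

/-- The block `z ⟨ᵏ z̄ᵏ ⟩ᵏ`. -/
def block (z : Letter) (k : ℕ) : List Token :=
  Token.core z :: (List.replicate k Token.lbr ++ List.replicate k (Token.bar z) ++
    List.replicate k Token.rbr)

/-- The concatenation of the blocks `z ⟨ᵏ z̄ᵏ ⟩ᵏ`, for `k` running through the list `l`. -/
def blocks (z : Letter) (l : List ℕ) : List Token :=
  l.flatMap (block z)

/-- The string language `{Aⁿ Bᵐ Cⁿ Dᵐ | n, m ≥ 1}`, where `Z = {z ⟨ᵏ z̄ᵏ ⟩ᵏ | k ≥ 0}` is the set of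
blocks of the letter `z`. -/
def CSDs : Set (List Token) :=
  {s | ∃ ka kb kc kd : List ℕ, 1 ≤ ka.length ∧ 1 ≤ kb.length ∧
    kc.length = ka.length ∧ kd.length = kb.length ∧
    s = blocks .a ka ++ blocks .b kb ++ blocks .c kc ++ blocks .d kd}

/-! ## Graphs and s-graphs -/

/-- Finite directed multigraphs with labelled edges.  The labels are the eight symbols, and possibly
some further labels from `Λ`. -/
structure Graph (Λ : Type) where
  V : Type
  E : Type
  finV : Finite V
  finE : Finite E
  src : E → V
  tgt : E → V
  lab : E → Sym ⊕ Λ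

/-- The number of edges. -/
noncomputable def Graph.size {Λ : Type} (g : Graph Λ) : ℕ := Nat.card g.E

/-- The number of `z`-edges. -/
noncomputable def Graph.edgeCount {Λ : Type} (g : Graph Λ) (z : Sym) : ℕ :=
  Nat.card {e : g.E // g.lab e = Sum.inl z}

/-- Isomorphism of graphs. -/
def Graph.Iso {Λ : Type} (g g' : Graph Λ) : Prop :=
  ∃ (φ : g.V ≃ g'.V) (ψ : g.E ≃ g'.E), ∀ e : g.E,
    g'.src (ψ e) = φ (g.src e) ∧ g'.tgt (ψ e) = φ (g.tgt e) ∧ g'.lab (ψ e) = g.lab e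

/-- An s-graph with source names in `Fin k`: a graph together with a partial map that assigns
vertices to source names. -/
structure SGraph (Λ : Type) (k : ℕ) extends Graph Λ where
  source : Fin k → Option V

namespace SGraph

variable {Λ : Type} {k : ℕ}

/-- The empty s-graph. -/
def empty (Λ : Type) (k : ℕ) : SGraph Λ k where
  V := Empty
  E := Empty
  finV := inferInstance
  finE := inferInstance
  src := Empty.elim
  tgt := Empty.elim
  lab := Empty.elim
  source := fun _ => none

/-- Two vertices of a disjoint union are to be merged: they carry the same source name. -/
inductive Glue (g h : SGraph Λ k) : g.V ⊕ h.V → g.V ⊕ h.V → Prop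
  | mk (a : Fin k) (u : g.V) (v : h.V) (hu : g.source a = some u) (hv : h.source a = some v) :
      Glue g h (Sum.inl u) (Sum.inr v)

/-- Parallel composition `g ∥ h`: the disjoint union, in which vertices that carry the same source
name are merged (`Quot` is the quotient by the equivalence relation generated by `Glue`). -/
def par (g h : SGraph Λ k) : SGraph Λ k where
  V := Quot (Glue g h)
  E := g.E ⊕ h.E
  finV :=
    have := g.finV
    have := h.finV
    Finite.of_surjective (Quot.mk (Glue g h)) Quot.mk_surjective
  finE :=
    have := g.finE
    have := h.finE
    inferInstance
  src := Sum.elim (fun e => Quot.mk _ (Sum.inl (g.src e))) (fun e => Quot.mk _ (Sum.inr (h.src e)))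
  tgt := Sum.elim (fun e => Quot.mk _ (Sum.inl (g.tgt e))) (fun e => Quot.mk _ (Sum.inr (h.tgt e)))
  lab := Sum.elim g.lab h.lab
  source := fun a =>
    match g.source a, h.source a with
    | some u, _ => some (Quot.mk _ (Sum.inl u))
    | none, some v => some (Quot.mk _ (Sum.inr v))
    | none, none => none

/-- Renaming: the source named `a` is renamed to `σ a`. -/
def rename (σ : Equiv.Perm (Fin k)) (g : SGraph Λ k) : SGraph Λ k where
  toGraph := g.toGraph
  source := fun a => g.source (σ.symm a)

/-- Forgetting the source name `a`. -/
def forget (a : Fin k) (g : SGraph Λ k) : SGraph Λ k where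
  toGraph := g.toGraph
  source := Function.update g.source a none

end SGraph

/-- Terms with variables `x₀, …, xₙ₋₁` over the operations of the algebra `HR_k` of s-graphs with
`k` source names: constants, parallel composition, renaming and forgetting of source names. -/
inductive HRTerm (Λ : Type) (k : ℕ) (n : ℕ) : Type 1 where
  | var (i : Fin n)
  | const (g : SGraph Λ k)
  | par (u v : HRTerm Λ k n)
  | rename (σ : Equiv.Perm (Fin k)) (u : HRTerm Λ k n)
  | forget (a : Fin k) (u : HRTerm Λ k n)

namespace HRTerm

variable {Λ : Type} {k n : ℕ}

/-- The value of a term in `HR_k`, for given values of the variables. -/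
def eval (ρ : Fin n → SGraph Λ k) : HRTerm Λ k n → SGraph Λ k
  | var i => ρ i
  | const g => g
  | par u v => (u.eval ρ).par (v.eval ρ)
  | rename σ u => (u.eval ρ).rename σ
  | forget a u => (u.eval ρ).forget a

/-- The number of occurrences of the variable `i` in a term. -/
def occ (i : Fin n) : HRTerm Λ k n → ℕ
  | var j => if j = i then 1 else 0
  | const _ => 0
  | par u v => u.occ i + v.occ i
  | rename _ u => u.occ i
  | forget _ u => u.occ i

end HRTerm

/-! ## Trees and contexts -/

/-- A finite ranked signature.  A symbol of rank 0 is a leaf label: it is displayed in strings as one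
token, or as the empty string (`none`).  The token is relevant for symbols of rank 0 only. -/
structure Signature where
  Op : Type
  finOp : Finite Op
  rank : Op → ℕ
  token : Op → Option Token

/-- Trees over a ranked signature. -/
inductive Tree (Δ : Signature) : Type where
  | node (f : Δ.Op) (ts : Fin (Δ.rank f) → Tree Δ)

/-- Contexts: trees with exactly one occurrence of a hole.  In `node f i ts C`, the `i`-th child is
the context `C` and the other children are the trees `ts j`. -/
inductive Ctx (Δ : Signature) : Type where
  | hole
  | node (f : Δ.Op) (i : Fin (Δ.rank f)) (ts : {j : Fin (Δ.rank f) // j ≠ i} → Tree Δ) (C : Ctx Δ)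

namespace Tree

variable {Δ : Signature}

/-- The height of a tree; leaves have height 1. -/
def height : Tree Δ → ℕ
  | node _ ts => 1 + Finset.univ.sup fun j => (ts j).height

/-- The projective (context-free) yield: the string of the leaves, from left to right. -/
def yield : Tree Δ → List Token
  | node f ts =>
    if Δ.rank f = 0 then (Δ.token f).toList else (List.ofFn fun j => (ts j).yield).flatten

end Tree

namespace Ctx

variable {Δ : Signature}

/-- `C[t]`: the tree `t` is put into the hole. -/
def plug : Ctx Δ → Tree Δ → Tree Δ
  | hole, t => t
  | node f i ts C, t => .node f fun j => if h : j = i then C.plug t else ts ⟨j, h⟩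

/-- `C[D]`: the context `D` is put into the hole. -/
def comp : Ctx Δ → Ctx Δ → Ctx Δ
  | hole, D => D
  | node f i ts C, D => node f i ts (C.comp D)

/-- The height of a context; the hole has height 0. -/
def height : Ctx Δ → ℕ
  | hole => 0
  | node _ _ ts C => 1 + max C.height (Finset.univ.sup fun j => (ts j).height)

/-- The string generated to the left of the hole. -/
def left : Ctx Δ → List Token
  | hole => []
  | node _ i ts C =>
    (List.ofFn fun j => if h : j < i then (ts ⟨j, h.ne⟩).yield else []).flatten ++ C.left

/-- The string generated to the right of the hole. -/
def right : Ctx Δ → List Token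
  | hole => []
  | node _ i ts C =>
    C.right ++ (List.ofFn fun j => if h : i < j then (ts ⟨j, h.ne'⟩).yield else []).flatten

/-- The yield of a context. -/
def yield (C : Ctx Δ) : List Token := C.left ++ C.right

/-- `pump C₂ C₃ C₄ i` is `vⁱ`, with `v⁰ = C₃` and `vⁱ⁺¹ = C₂[vⁱ[C₄]]`. -/
def pump (C₂ C₃ C₄ : Ctx Δ) : ℕ → Ctx Δ
  | 0 => C₃
  | i + 1 => C₂.comp ((pump C₂ C₃ C₄ i).comp C₄)

end Ctx

/-! ## Linear monadic context-free tree grammars -/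

/-- Sentential forms over a signature, with nonterminals of rank 0 in `N₀` and of rank 1 in `N₁`, and
a variable `x`. -/
inductive Form (Δ : Signature) (N₀ N₁ : Type) : Type where
  | x
  | node (f : Δ.Op) (ts : Fin (Δ.rank f) → Form Δ N₀ N₁)
  | nt₀ (A : N₀)
  | nt₁ (A : N₁) (u : Form Δ N₀ N₁)

namespace Form

variable {Δ : Signature} {N₀ N₁ : Type}

/-- The number of occurrences of the variable. -/
def occ : Form Δ N₀ N₁ → ℕ
  | x => 1
  | node _ ts => ∑ j, (ts j).occ
  | nt₀ _ => 0
  | nt₁ _ u => u.occ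

/-- Substitution of `s` for the variable. -/
def subst (s : Form Δ N₀ N₁) : Form Δ N₀ N₁ → Form Δ N₀ N₁
  | x => s
  | node f ts => node f fun j => subst s (ts j)
  | nt₀ A => nt₀ A
  | nt₁ A u => nt₁ A (subst s u)

/-- A tree as a sentential form. -/
def ofTree : Tree Δ → Form Δ N₀ N₁
  | .node f ts => node f fun j => ofTree (ts j)

end Form

/-- Linear monadic context-free tree grammars: nonterminals have rank 0 or 1; the rules are `A → u`
where `u` has no variable, and `A(x) → u` where `x` occurs at most once in `u`. -/
structure LMCFTG (Δ : Signature) where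
  N₀ : Type
  N₁ : Type
  finN₀ : Finite N₀
  finN₁ : Finite N₁
  start : N₀
  rules₀ : Set (N₀ × Form Δ N₀ N₁)
  rules₁ : Set (N₁ × Form Δ N₀ N₁)
  fin₀ : rules₀.Finite
  fin₁ : rules₁.Finite
  closed : ∀ r ∈ rules₀, r.2.occ = 0
  linear : ∀ r ∈ rules₁, r.2.occ ≤ 1

namespace LMCFTG

variable {Δ : Signature}

/-- One derivation step. -/
inductive Step (G : LMCFTG Δ) : Form Δ G.N₀ G.N₁ → Form Δ G.N₀ G.N₁ → Prop
  | rule₀ {A : G.N₀} {u : Form Δ G.N₀ G.N₁} (h : (A, u) ∈ G.rules₀) : Step G (.nt₀ A) u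
  | rule₁ {A : G.N₁} {u : Form Δ G.N₀ G.N₁} (h : (A, u) ∈ G.rules₁) (s : Form Δ G.N₀ G.N₁) :
      Step G (.nt₁ A s) (Form.subst s u)
  | node (f : Δ.Op) (ts : Fin (Δ.rank f) → Form Δ G.N₀ G.N₁) (i : Fin (Δ.rank f))
      {u : Form Δ G.N₀ G.N₁} (h : Step G (ts i) u) :
      Step G (.node f ts) (.node f (Function.update ts i u))
  | nt₁ (A : G.N₁) {s u : Form Δ G.N₀ G.N₁} (h : Step G s u) : Step G (.nt₁ A s) (.nt₁ A u)

/-- The tree language generated by a grammar. -/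
def language (G : LMCFTG Δ) : Set (Tree Δ) :=
  {t | Relation.ReflTransGen G.Step (.nt₀ G.start) (Form.ofTree t)}

end LMCFTG

/-! ## Semantic interpretation of trees -/

/-- Tree homomorphisms from trees over `Δ` to terms over `HR_k`; they are linear and nondeleting,
i.e. every variable occurs exactly once in the image of a symbol. -/
structure Hom (Δ : Signature) (Λ : Type) (k : ℕ) where
  image : (f : Δ.Op) → HRTerm Λ k (Δ.rank f)
  occ_eq_one : ∀ (f : Δ.Op) (i : Fin (Δ.rank f)), (image f).occ i = 1

namespace Hom

variable {Δ : Signature} {Λ : Type} {k : ℕ}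

/-- The s-graph `⟦h(t)⟧` of a tree `t`. -/
def graph (h : Hom Δ Λ k) : Tree Δ → SGraph Λ k
  | .node f ts => (h.image f).eval fun j => h.graph (ts j)

/-- The s-graph generated by a context alone, i.e. with the empty s-graph in place of the hole. -/
def ctxGraph (h : Hom Δ Λ k) : Ctx Δ → SGraph Λ k
  | .hole => SGraph.empty Λ k
  | .node f i ts C =>
    (h.image f).eval fun j => if hj : j = i then h.ctxGraph C else h.graph (ts ⟨j, hj⟩)

end Hom

/-- The relation `REL((G, yield), h, HR_k)` between strings and graphs (graphs are considered up to
isomorphism, and without their source names). -/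
def REL {Δ : Signature} {Λ : Type} {k : ℕ} (G : LMCFTG Δ) (h : Hom Δ Λ k) :
    Set (List Token × Graph Λ) :=
  {q | ∃ t ∈ G.language, t.yield = q.1 ∧ (h.graph t).toGraph.Iso q.2}

/-- Relations between strings and graphs that relate exactly the strings of `CSDs`, each of them only
to graphs with exactly one `z`-edge for every `z`-token of the string, for all eight symbols `z`. -/
structure IsCSD {Λ : Type} (R : Set (List Token × Graph Λ)) : Prop where
  strings : ∀ s : List Token, (∃ g, (s, g) ∈ R) ↔ s ∈ CSDs
  edges : ∀ (s : List Token) (g : Graph Λ), (s, g) ∈ R →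
    ∀ z : Sym, g.edgeCount z = s.count (Token.sym z)

/-! ## Pumping -/

/-- `(C₁, C₂, C₃, C₄, t₅)` is a pumping decomposition of `t` in `T`, for the bound `p`. -/
structure IsPumpingDecomposition {Δ : Signature} (T : Set (Tree Δ)) (p : ℕ) (t : Tree Δ)
    (C₁ C₂ C₃ C₄ : Ctx Δ) (t₅ : Tree Δ) : Prop where
  eq : t = C₁.plug (C₂.plug (C₃.plug (C₄.plug t₅)))
  height_le : (C₂.comp (C₃.comp C₄)).height ≤ p
  height_pos : 0 < C₂.height + C₄.height
  mem : ∀ i : ℕ, C₁.plug ((Ctx.pump C₂ C₃ C₄ i).plug t₅) ∈ T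

/-- `p` is a pumping height of `T`: every tree of `T` of height greater than `p` has a pumping
decomposition. -/
def IsPumpingHeight {Δ : Signature} (T : Set (Tree Δ)) (p : ℕ) : Prop :=
  ∀ t ∈ T, p < t.height → ∃ C₁ C₂ C₃ C₄ t₅, IsPumpingDecomposition T p t C₁ C₂ C₃ C₄ t₅

/-- Every context of height at most `p` generates at most `l` string tokens and at most `l` edges. -/
def IsGenerationBound {Δ : Signature} {Λ : Type} {k : ℕ} (h : Hom Δ Λ k) (p l : ℕ) : Prop :=
  ∀ C : Ctx Δ, C.height ≤ p → C.yield.length ≤ l ∧ (h.ctxGraph C).size ≤ l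

/-! ## Separation and asynchrony -/

/-- `t = Dx[D₀[ty]]` is an `x,y,l`-separation of `t`. -/
structure IsSeparation {Δ : Signature} (x y : Letter) (l : ℕ) (t : Tree Δ)
    (Dx D₀ : Ctx Δ) (ty : Tree Δ) : Prop where
  eq : t = Dx.plug (D₀.plug ty)
  outer : Dx.yield.count (Token.core y) = 0
  middle : D₀.yield.count (Token.core x) ≤ l
  inner : ty.yield.count (Token.core x) = 0

/-- A separation is minimal if the height of its middle context is minimal. -/
def IsMinimalSeparation {Δ : Signature} (x y : Letter) (l : ℕ) (t : Tree Δ)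
    (Dx D₀ : Ctx Δ) (ty : Tree Δ) : Prop :=
  IsSeparation x y l t Dx D₀ ty ∧
    ∀ Ex E₀ sy, IsSeparation x y l t Ex E₀ sy → D₀.height ≤ E₀.height

/-- `t` is `x,y,l`-separated. -/
def Separated {Δ : Signature} (x y : Letter) (l : ℕ) (t : Tree Δ) : Prop :=
  ∃ Dx D₀ ty, IsSeparation x y l t Dx D₀ ty

/-- `t` is `x,y,l`-asynchronous: it has a minimal `x,y,l`-separation `Dx[D₀[ty]]` such that, for
`t₀ = D₀[ty]`, the number of `x̄`-edges of `t₀` is at most `nₓ l + m_x̄ (l + 1)` and the number of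
`ȳ`-edges of `t₀` is at least `n_ȳ - nₓ l - m_ȳ` (an integer).  Here `n_z` is the number of
`z`-tokens, and `m_z` the maximal length of a sequence of consecutive `z`-tokens, in the yield
of `t`. -/
def Asynchronous {Δ : Signature} {Λ : Type} {k : ℕ} (h : Hom Δ Λ k) (x y : Letter) (l : ℕ)
    (t : Tree Δ) : Prop :=
  ∃ Dx D₀ ty, IsMinimalSeparation x y l t Dx D₀ ty ∧
    (h.graph (D₀.plug ty)).edgeCount (.bar x) ≤
      t.yield.count (Token.core x) * l + maxRun (Token.bar x) t.yield * (l + 1) ∧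
    ((h.graph (D₀.plug ty)).edgeCount (.bar y) : ℤ) ≥
      (t.yield.count (Token.bar y) : ℤ) - t.yield.count (Token.core x) * l -
        maxRun (Token.bar y) t.yield

end SemCap

/-!
A pumping height is found by the pigeonhole principle, on the nonterminals along a long path of a
derivation.

For the asynchrony, call the number of `z̄`-tokens minus the number of `z̄`-edges of a tree its
surplus. Every variable occurs exactly once in the image of a symbol under `h`, hence surpluses are
additive, and they vanish on `L(G)`. In a minimal separation, `t₀` has at most `l` tokens `x`, so its
`x̄` form at most `l + 1` groups, and by additivity it remains to see that if `E[t]` is in `L(G)` and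
`E` generates no `y`, then the surplus of `t` is at least `-nₓ l` for `x`, and at most
`nₓ l + m_ȳ` for `y`.

This goes by induction on `E[t]`. If `E[t]` is low, then `E` generates at most `l` tokens and edges.
Otherwise pump down. All pumped strings being concatenations of blocks, the pumped contexts
generate as many barred letters as opening and as closing brackets, so the surplus of any part of
them lies between `-l / 3` and `l / 3`. They also generate as many `x` as `y`. If they generate
some, then `nₓ` decreases and the bounds have room for the change of the surplus. If not, then `x̄`
and `ȳ` cannot be pumped either in those parts that could spoil the bounds, except within the last
run of `ȳ` of `t`, which `m_ȳ` pays for.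
-/

namespace SemCap

/-! ## Trees and contexts -/

theorem flatten_ofFn_split {α : Type*} : ∀ {n : ℕ} (g : Fin n → List α) (i : Fin n),
    (List.ofFn g).flatten = (List.ofFn fun j => if j < i then g j else []).flatten ++ g i ++
      (List.ofFn fun j => if i < j then g j else []).flatten
  | 0, _, i => i.elim0
  | n + 1, g, i => by
    cases i using Fin.cases with
    | zero => simp [List.ofFn_succ]
    | succ i =>
      rw [List.ofFn_succ, List.flatten_cons, flatten_ofFn_split (fun j => g j.succ) i]
      simp [List.ofFn_succ]

section Trees

variable {Δ : Signature}

/-- The total weight of the symbols of a tree, where an occurrence of `f` has the weight `c f`.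
Both the size of a tree and its number of `z`-edges are weights. -/
def Tree.weight (c : Δ.Op → ℕ) : Tree Δ → ℕ
  | .node f ts => c f + ∑ j, (ts j).weight c

/-- The total weight of the symbols of a context; the hole has no weight. -/
def Ctx.weight (c : Δ.Op → ℕ) : Ctx Δ → ℕ
  | .hole => 0
  | .node f _ ts C => c f + (C.weight c + ∑ j, (ts j).weight c)

namespace Ctx

theorem eq_hole {C : Ctx Δ} (h : C.height = 0) : C = .hole := by
  cases C with
  | hole => rfl
  | node f i ts C => simp [height] at h

@[simp] theorem comp_hole (C : Ctx Δ) : C.comp .hole = C := by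
  induction C with
  | hole => rfl
  | node f i ts C ih => rw [comp, ih]

theorem comp_assoc (C D E : Ctx Δ) : (C.comp D).comp E = C.comp (D.comp E) := by
  induction C with
  | hole => rfl
  | node f i ts C ih => simp only [comp, ih]

theorem plug_comp (C D : Ctx Δ) (t : Tree Δ) : (C.comp D).plug t = C.plug (D.plug t) := by
  induction C with
  | hole => rfl
  | node f i ts C ih => simp [comp, plug, ih]

theorem node_update_eq_plug (f : Δ.Op) (ts : Fin (Δ.rank f) → Tree Δ)
    (i : Fin (Δ.rank f)) (t : Tree Δ) :
    Tree.node f (Function.update ts i t) = (node f i (fun j => ts j) .hole).plug t := by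
  simp only [plug, Tree.node.injEq, heq_eq_eq, true_and]
  grind

theorem plug_node_update {f : Δ.Op} {i : Fin (Δ.rank f)}
    (ts : {j : Fin (Δ.rank f) // j ≠ i} → Tree Δ) (C : Ctx Δ) (j : {j // j ≠ i}) (s t : Tree Δ) :
    (node f i (Function.update ts j t) C).plug s = (node f j (fun k =>
      if hk : (k : Fin (Δ.rank f)) = i then C.plug s else ts ⟨k, hk⟩) .hole).plug t := by
  simp only [plug, Tree.node.injEq, heq_eq_eq, true_and]
  grind

theorem left_comp (C D : Ctx Δ) : (C.comp D).left = C.left ++ D.left := by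
  induction C with
  | hole => rfl
  | node f i ts C ih => simp [comp, left, ih]

theorem right_comp (C D : Ctx Δ) : (C.comp D).right = D.right ++ C.right := by
  induction C with
  | hole => simp [comp, right]
  | node f i ts C ih => simp [comp, right, ih]

theorem weight_comp (c : Δ.Op → ℕ) (C D : Ctx Δ) :
    (C.comp D).weight c = C.weight c + D.weight c := by
  induction C with
  | hole => simp [comp, weight]
  | node f i ts C ih =>
    simp only [comp, weight, ih]
    ring

theorem weight_plug (c : Δ.Op → ℕ) (C : Ctx Δ) (t : Tree Δ) :
    (C.plug t).weight c = C.weight c + t.weight c := by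
  induction C with
  | hole => simp [plug, weight]
  | node f i ts C ih =>
    have hts (j : {j // j ≠ i}) :
        (if h : (j : Fin _) = i then C.plug t else ts ⟨j, h⟩) = ts j := dif_neg j.2
    simp only [plug, Tree.weight, weight, Fintype.sum_eq_add_sum_subtype_ne _ i, dif_pos, ih, hts]
    ring

theorem yield_plug (C : Ctx Δ) (t : Tree Δ) :
    (C.plug t).yield = C.left ++ t.yield ++ C.right := by
  induction C with
  | hole => simp [plug, left, right]
  | node f i ts C ih =>
    have hl (j : Fin (Δ.rank f)) : (if j < i then
        (if h : j = i then C.plug t else ts ⟨j, h⟩).yield else []) =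
        if h : j < i then (ts ⟨j, h.ne⟩).yield else [] := by
      split_ifs <;> grind
    have hr (j : Fin (Δ.rank f)) : (if i < j then
        (if h : j = i then C.plug t else ts ⟨j, h⟩).yield else []) =
        if h : i < j then (ts ⟨j, h.ne'⟩).yield else [] := by
      split_ifs <;> grind
    rw [plug, Tree.yield, if_neg i.pos.ne', flatten_ofFn_split _ i]
    simp only [hl, hr, dif_pos, ih, left, right, List.append_assoc]

theorem yield_sublist_plug (C : Ctx Δ) (t : Tree Δ) : t.yield.Sublist (C.plug t).yield := by
  rw [yield_plug, List.append_assoc]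
  exact (List.sublist_append_left _ _).trans (List.sublist_append_right _ _)

theorem yield_plug_sublist (C : Ctx Δ) {s t : Tree Δ} (h : s.yield.Sublist t.yield) :
    (C.plug s).yield.Sublist (C.plug t).yield := by
  simp only [yield_plug]
  exact ((List.Sublist.refl _).append h).append (List.Sublist.refl _)

theorem height_le_plug (C : Ctx Δ) (t : Tree Δ) : C.height ≤ (C.plug t).height := by
  induction C with
  | hole => exact Nat.zero_le _
  | node f i ts C ih =>
    have hsup (j : Fin (Δ.rank f)) := Finset.le_sup (f := fun j =>
      (if h : j = i then C.plug t else ts ⟨j, h⟩).height) (Finset.mem_univ j)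
    refine Nat.add_le_add_left (max_le (ih.trans ?_) (Finset.sup_le fun j _ => ?_)) 1
    · simpa using hsup i
    · simpa [j.2] using hsup j

theorem height_plug_le (C : Ctx Δ) (t : Tree Δ) : (C.plug t).height ≤ C.height + t.height := by
  induction C with
  | hole => exact Nat.le_add_left _ _
  | node f i ts C ih =>
    simp only [plug, Tree.height, height, Nat.add_assoc, Nat.add_le_add_iff_left]
    refine Finset.sup_le fun j _ => ?_
    have hts (hj : j ≠ i) := Finset.le_sup (f := fun j : {j // j ≠ i} => (ts j).height)
      (Finset.mem_univ ⟨j, hj⟩)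
    grind

theorem height_comp_le (C D : Ctx Δ) : (C.comp D).height ≤ C.height + D.height := by
  induction C with
  | hole => exact Nat.le_add_left _ _
  | node f i ts C ih =>
    simp only [comp, height]
    omega

theorem weight_pos {C : Ctx Δ} (h : 0 < C.height) : 0 < C.weight fun _ => 1 := by
  cases C with
  | hole => exact h
  | node f i ts C => exact Nat.add_pos_left one_pos _

theorem exists_flatten_update_of_pos {n : ℕ} (P : Fin n → Prop) [DecidablePred P]
    (r : Fin n → Tree Δ) {i : Fin n} (hi : P i) :
    ∃ β γ, ∀ t, (List.ofFn fun k => if P k then (Function.update r i t k).yield else []).flatten =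
      β ++ t.yield ++ γ := by
  refine ⟨(List.ofFn fun k => if k < i then if P k then (r k).yield else [] else []).flatten,
    (List.ofFn fun k => if i < k then if P k then (r k).yield else [] else []).flatten,
    fun t => ?_⟩
  rw [flatten_ofFn_split _ i, if_pos hi, Function.update_self]
  congr! 6 with k hk _ k hk _
  · rw [Function.update_of_ne hk.ne]
  · rw [Function.update_of_ne hk.ne']

theorem exists_flatten_update_of_neg {n : ℕ} (P : Fin n → Prop) [DecidablePred P]
    (r : Fin n → Tree Δ) {i : Fin n} (hi : ¬P i) :
    ∃ α, ∀ t, (List.ofFn fun k => if P k then (Function.update r i t k).yield else []).flatten =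
      α := by
  refine ⟨(List.ofFn fun k => if P k then (r k).yield else []).flatten, fun t => ?_⟩
  congr! 4 with k hk
  rw [Function.update_of_ne]
  rintro rfl
  exact hi hk

/-- `Beside C w K`: the tree `w` hangs off the path from the root of `C` to its hole, so that in
`C[u]` the positions of `u` and `w` are incomparable; `K u` is what surrounds `w` in `C[u]`.  In
`branch`, the children of the node at which the paths to `u` and `w` part are given by `r`, whose
value at `i` is irrelevant. -/
inductive Beside : Ctx Δ → Tree Δ → (Tree Δ → Ctx Δ) → Prop
  | branch (f : Δ.Op) {i j : Fin (Δ.rank f)} (hij : i ≠ j) (r : Fin (Δ.rank f) → Tree Δ)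
      (C D : Ctx Δ) (w : Tree Δ) (hw : r j = D.plug w) :
      Beside (node f i (fun k => r k) C) w fun u =>
        node f j (fun k => Function.update r i (C.plug u) k) D
  | node (f : Δ.Op) (i : Fin (Δ.rank f)) (ts : {j : Fin (Δ.rank f) // j ≠ i} → Tree Δ) {C : Ctx Δ}
      {w : Tree Δ} {K : Tree Δ → Ctx Δ} (h : Beside C w K) :
      Beside (node f i ts C) w fun u => node f i ts (K u)

namespace Beside

variable {C : Ctx Δ} {w : Tree Δ} {K : Tree Δ → Ctx Δ}

theorem plug_eq (h : C.Beside w K) (u : Tree Δ) : (K u).plug w = C.plug u := by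
  induction h with
  | branch f hij r C D w hw =>
    simp only [plug, Tree.node.injEq, heq_eq_eq, true_and]
    funext k
    grind
  | node f i ts _ ih => simp only [plug, ih]

/-- `u` lies entirely on one side of `w` in `C[u]`. -/
theorem left_right_eq (h : C.Beside w K) :
    (∃ α β γ, ∀ u, (K u).left = α ∧ (K u).right = β ++ u.yield ++ γ) ∨
      ∃ α β γ, ∀ u, (K u).left = α ++ u.yield ++ β ∧ (K u).right = γ := by
  induction h with
  | @branch f i j hij r C D =>
    rcases hij.lt_or_gt with hlt | hlt
    · obtain ⟨β, γ, hl⟩ := exists_flatten_update_of_pos (· < j) r hlt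
      obtain ⟨α, hr⟩ := exists_flatten_update_of_neg (j < ·) r hlt.not_gt
      refine .inr ⟨β ++ C.left, C.right ++ γ ++ D.left, D.right ++ α, fun u => ⟨?_, ?_⟩⟩
      · simp only [left, dite_eq_ite, hl, yield_plug, List.append_assoc]
      · simp only [right, dite_eq_ite, hr]
    · obtain ⟨α, hl⟩ := exists_flatten_update_of_neg (· < j) r hlt.not_gt
      obtain ⟨β, γ, hr⟩ := exists_flatten_update_of_pos (j < ·) r hlt
      refine .inl ⟨α ++ D.left, D.right ++ β ++ C.left, C.right ++ γ, fun u => ⟨?_, ?_⟩⟩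
      · simp only [left, dite_eq_ite, hl]
      · simp only [right, dite_eq_ite, hr, yield_plug, List.append_assoc]
  | node f i ts _ ih =>
    rcases ih with ⟨α, β, γ, h⟩ | ⟨α, β, γ, h⟩
    · exact .inl ⟨_, β, γ ++ _, fun u => ⟨by rw [left, (h u).1], by
        rw [right, (h u).2, List.append_assoc]⟩⟩
    · exact .inr ⟨_ ++ α, β, _, fun u => ⟨by
        rw [left, (h u).1, ← List.append_assoc, ← List.append_assoc], by rw [right, (h u).2]⟩⟩

theorem weight_le (h : C.Beside w K) (c : Δ.Op → ℕ) : w.weight c ≤ C.weight c := by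
  induction h with
  | @branch f i j hij r C D w hw =>
    have hj := Finset.single_le_sum (f := fun k : {k // k ≠ i} => (r k).weight c)
      (fun _ _ => Nat.zero_le _) (Finset.mem_univ ⟨j, hij.symm⟩)
    simp only [hw, weight_plug] at hj
    rw [weight]
    omega
  | node f i ts _ ih =>
    rw [weight]
    omega

theorem length_yield_le (h : C.Beside w K) : w.yield.length ≤ C.yield.length := by
  have hw := congrArg (fun t => t.yield.length) (h.plug_eq w)
  rcases h.left_right_eq with ⟨α, β, γ, hK⟩ | ⟨α, β, γ, hK⟩ <;>
  · simp only [yield_plug, hK, List.length_append] at hw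
    simp only [yield, List.length_append]
    omega

end Beside

theorem compare (C : Ctx Δ) : ∀ (D : Ctx Δ) (u w : Tree Δ), C.plug u = D.plug w →
    (∃ F, C = D.comp F ∧ w = F.plug u) ∨ (∃ F, D = C.comp F ∧ u = F.plug w) ∨
      ∃ K, D = K u ∧ C.Beside w K := by
  induction C with
  | hole => exact fun D u w h => .inr (.inl ⟨D, rfl, h⟩)
  | node f i ts C ih =>
    intro D u w h
    cases D with
    | hole => exact .inl ⟨_, rfl, h.symm⟩
    | node g j ss D =>
      simp only [plug, Tree.node.injEq] at h
      obtain ⟨rfl, h⟩ := h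
      have h := congrFun (eq_of_heq h)
      rcases eq_or_ne i j with rfl | hij
      · obtain rfl : ts = ss := funext fun k => by simpa [k.2] using h k
        have hi : C.plug u = D.plug w := by simpa using h i
        rcases ih D u w hi with ⟨F, rfl, rfl⟩ | ⟨F, rfl, rfl⟩ | ⟨K, rfl, hK⟩
        · exact .inl ⟨F, rfl, rfl⟩
        · exact .inr (.inl ⟨F, rfl, rfl⟩)
        · exact .inr (.inr ⟨_, rfl, hK.node f i ts⟩)
      · let r (k : Fin (Δ.rank f)) : Tree Δ := if hk : k = j then D.plug w else ss ⟨k, hk⟩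
        have hts : ts = fun k : {k // k ≠ i} => r k := by
          funext k
          simpa [k.2] using h k
        have hss : ss = fun k : {k // k ≠ j} => Function.update r i (C.plug u) k := by
          funext k
          have hi := h i
          grind
        rw [hts, hss]
        exact .inr (.inr ⟨_, rfl, .branch f hij r C D w (dif_pos rfl)⟩)

end Ctx

end Trees

/-! ## Numbers of edges -/

section Edges

variable {Λ : Type} {k n : ℕ}

theorem SGraph.edgeCount_empty (z : Sym) : (SGraph.empty Λ k).edgeCount z = 0 :=
  have : IsEmpty {e : (SGraph.empty Λ k).E // (SGraph.empty Λ k).lab e = Sum.inl z} :=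
    ⟨fun e => nomatch e.1⟩
  Nat.card_of_isEmpty

theorem SGraph.edgeCount_par (z : Sym) (g g' : SGraph Λ k) :
    (g.par g').edgeCount z = g.edgeCount z + g'.edgeCount z := by
  have := g.finE
  have := g'.finE
  rw [Graph.edgeCount, Graph.edgeCount, Graph.edgeCount, ← Nat.card_sum]
  exact Nat.card_congr Equiv.subtypeSum

theorem HRTerm.edgeCount_eval (z : Sym) (ρ : Fin n → SGraph Λ k) (u : HRTerm Λ k n) :
    (u.eval ρ).edgeCount z = (u.eval fun _ => SGraph.empty Λ k).edgeCount z +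
      ∑ i, u.occ i * (ρ i).edgeCount z := by
  induction u with
  | var i => simp [eval, occ, SGraph.edgeCount_empty]
  | const g => simp [eval, occ]
  | par u v hu hv =>
    simp only [eval, occ, SGraph.edgeCount_par, hu, hv, add_mul, Finset.sum_add_distrib]
    ring
  | rename _ _ hu => exact hu
  | forget _ _ hu => exact hu

namespace Hom

variable {Δ : Signature} (h : Hom Δ Λ k)

/-- The number of `z`-edges of the image of a symbol `f`, not counting those of the arguments.
Since `h` is linear and nondeleting, these numbers add up to the number of `z`-edges of a graph. -/
noncomputable def edges (z : Sym) (f : Δ.Op) : ℕ :=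
  ((h.image f).eval fun _ => SGraph.empty Λ k).edgeCount z

theorem edgeCount_graph (z : Sym) (t : Tree Δ) :
    (h.graph t).edgeCount z = t.weight (h.edges z) := by
  induction t with
  | node f ts ih =>
    rw [graph, HRTerm.edgeCount_eval]
    simp only [h.occ_eq_one, one_mul, ih, Tree.weight, edges]

theorem edgeCount_ctxGraph (z : Sym) (C : Ctx Δ) :
    (h.ctxGraph C).edgeCount z = C.weight (h.edges z) := by
  induction C with
  | hole => exact SGraph.edgeCount_empty z
  | node f i ts C ih =>
    have hts (j : {j // j ≠ i}) :
        (if hj : (j : Fin _) = i then h.ctxGraph C else h.graph (ts ⟨j, hj⟩)) = h.graph (ts j) :=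
      dif_neg j.2
    rw [ctxGraph, HRTerm.edgeCount_eval, Fintype.sum_eq_add_sum_subtype_ne _ i]
    simp only [h.occ_eq_one, one_mul, dif_pos, ih, hts, edgeCount_graph, Ctx.weight, edges]

theorem weight_edges_le_size (C : Ctx Δ) (z : Sym) :
    C.weight (h.edges z) ≤ (h.ctxGraph C).size := by
  have := (h.ctxGraph C).finE
  rw [← h.edgeCount_ctxGraph]
  exact Finite.card_subtype_le _

end Hom

end Edges

/-! ## Contexts of bounded height -/

section Bounded

variable {Δ : Signature}

theorem finite_height_le (n : ℕ) : {t : Tree Δ | t.height ≤ n}.Finite := by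
  have := Δ.finOp
  induction n with
  | zero => exact Set.finite_empty.subset fun ⟨f, ts⟩ ht => by simp [Tree.height] at ht
  | succ n ih =>
    have := ih.to_subtype
    refine (Set.finite_range fun q : (f : Δ.Op) × (Fin (Δ.rank f) → {t : Tree Δ | t.height ≤ n}) =>
      Tree.node q.1 fun j => (q.2 j).1).subset ?_
    rintro ⟨f, ts⟩ ht
    have hts : (Finset.univ.sup fun j => (ts j).height) ≤ n := by
      simp only [Tree.height, Set.mem_ofPred_eq] at ht
      omega
    exact ⟨⟨f, fun j => ⟨ts j, Finset.sup_le_iff.mp hts j (Finset.mem_univ j)⟩⟩, rfl⟩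

theorem finite_ctx_height_le (n : ℕ) : {C : Ctx Δ | C.height ≤ n}.Finite := by
  have := Δ.finOp
  induction n with
  | zero =>
    refine (Set.finite_singleton Ctx.hole).subset ?_
    rintro (_ | ⟨f, i, ts, C⟩) hC
    · rfl
    · simp [Ctx.height] at hC
  | succ n ih =>
    have := ih.to_subtype
    have := (finite_height_le (Δ := Δ) n).to_subtype
    refine ((Set.finite_singleton Ctx.hole).union (Set.finite_range
      fun q : (f : Δ.Op) × (i : Fin (Δ.rank f)) × ({j : Fin (Δ.rank f) // j ≠ i} →
        {t : Tree Δ | t.height ≤ n}) × {C : Ctx Δ | C.height ≤ n} =>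
      Ctx.node q.1 q.2.1 (fun j => (q.2.2.1 j).1) q.2.2.2.1)).subset ?_
    rintro (_ | ⟨f, i, ts, C⟩) hC
    · exact .inl rfl
    · have hC : C.height ≤ n ∧ (Finset.univ.sup fun j => (ts j).height) ≤ n := by
        simp only [Ctx.height, Set.mem_ofPred_eq] at hC
        omega
      exact .inr ⟨⟨f, i, fun j => ⟨ts j, Finset.sup_le_iff.mp hC.2 j (Finset.mem_univ j)⟩,
        ⟨C, hC.1⟩⟩, rfl⟩

theorem exists_isGenerationBound {Λ : Type} {k : ℕ} (h : Hom Δ Λ k) (p : ℕ) :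
    ∃ l, IsGenerationBound h p l := by
  obtain ⟨l, hl⟩ := ((finite_ctx_height_le (Δ := Δ) p).image
    fun C => C.yield.length + (h.ctxGraph C).size).bddAbove
  refine ⟨l, fun C hC => ?_⟩
  have : C.yield.length + (h.ctxGraph C).size ≤ l := hl ⟨C, hC, rfl⟩
  omega

end Bounded

/-! ## Big-step semantics of grammars -/

section Grammar

variable {Δ : Signature}

/-- A tree, or a context. -/
inductive Val (Δ : Signature) : Bool → Type where
  | tree (t : Tree Δ) : Val Δ false
  | ctx (C : Ctx Δ) : Val Δ true

namespace Val

/-- The tree obtained by putting `s` into the hole, if there is one. -/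
def fill (s : Tree Δ) : {b : Bool} → Val Δ b → Tree Δ
  | _, tree t => t
  | _, ctx C => C.plug s

theorem tree_fill (v : Val Δ false) (s : Tree Δ) : tree (v.fill s) = v := by
  cases v
  rfl

/-- The height of a tree or a context. -/
def height : {b : Bool} → Val Δ b → ℕ
  | _, tree t => t.height
  | _, ctx C => C.height

end Val

namespace Form

variable {N₀ N₁ : Type}

theorem subst_of_occ_eq_zero (s u : Form Δ N₀ N₁) (h : u.occ = 0) : subst s u = u := by
  induction u with
  | x => simp [occ] at h
  | node f ts ih =>
    simp only [occ, Finset.sum_eq_zero_iff, Finset.mem_univ, true_imp_iff] at h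
    simp only [subst, fun j => ih j (h j)]
  | nt₀ A => rfl
  | nt₁ A u ih => simp only [subst, ih h]

theorem occ_eq_zero_of_ne {f : Δ.Op} {us : Fin (Δ.rank f) → Form Δ N₀ N₁}
    (h : (node f us).occ ≤ 1) {i j : Fin (Δ.rank f)} (hij : j ≠ i) (hi : 0 < (us i).occ) :
    (us j).occ = 0 := by
  have hsum := Finset.sum_le_sum_of_subset (f := fun k => (us k).occ) (Finset.subset_univ {i, j})
  rw [Finset.sum_pair hij.symm] at hsum
  rw [occ] at h
  omega

/-- The set of subforms of a form. -/
def subforms : Form Δ N₀ N₁ → Set (Form Δ N₀ N₁)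
  | x => {x}
  | node f us => insert (node f us) (⋃ j, subforms (us j))
  | nt₀ A => {nt₀ A}
  | nt₁ A u => insert (nt₁ A u) (subforms u)

theorem self_mem_subforms (u : Form Δ N₀ N₁) : u ∈ u.subforms := by
  cases u <;> simp [subforms]

theorem finite_subforms (u : Form Δ N₀ N₁) : u.subforms.Finite := by
  induction u with
  | x => exact Set.finite_singleton _
  | node f us ih => exact (Set.finite_iUnion ih).insert _
  | nt₀ A => exact Set.finite_singleton _
  | nt₁ A u ih => exact ih.insert _

theorem subforms_subset {u v : Form Δ N₀ N₁} (h : v ∈ u.subforms) : v.subforms ⊆ u.subforms := by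
  induction u with
  | x => rw [Set.mem_singleton_iff.mp h]
  | node f us ih =>
    rcases h with rfl | h
    · rfl
    · obtain ⟨j, hj⟩ := Set.mem_iUnion.mp h
      exact (ih j hj).trans ((Set.subset_iUnion (fun j => (us j).subforms) j).trans
        (Set.subset_insert _ _))
  | nt₀ A => rw [Set.mem_singleton_iff.mp h]
  | nt₁ A u ih =>
    rcases h with rfl | h
    · rfl
    · exact (ih h).trans (Set.subset_insert _ _)

end Form

namespace LMCFTG

variable {G : LMCFTG Δ}

/-- The judgment that a form derives a certain tree, or a certain context. -/
structure Judgment (G : LMCFTG Δ) where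
  form : Form Δ G.N₀ G.N₁
  {b : Bool}
  val : Val Δ b

/-- `G.Inference φ v P`: the judgment that `φ` derives `v` can be inferred from the judgments
in `P`. -/
inductive Inference (G : LMCFTG Δ) :
    Form Δ G.N₀ G.N₁ → {b : Bool} → Val Δ b → Set G.Judgment → Prop
  | node (f : Δ.Op) (φs : Fin (Δ.rank f) → Form Δ G.N₀ G.N₁) (ts : Fin (Δ.rank f) → Tree Δ) :
      Inference G (.node f φs) (.tree (.node f ts)) (Set.range fun j => ⟨φs j, .tree (ts j)⟩)
  | nt₀ {A : G.N₀} {u : Form Δ G.N₀ G.N₁} (h : (A, u) ∈ G.rules₀) (t : Tree Δ) :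
      Inference G (.nt₀ A) (.tree t) {⟨u, .tree t⟩}
  | plug {A : G.N₁} {u : Form Δ G.N₀ G.N₁} (h : (A, u) ∈ G.rules₁) (v : Form Δ G.N₀ G.N₁)
      (C : Ctx Δ) (t : Tree Δ) :
      Inference G (.nt₁ A v) (.tree (C.plug t)) {⟨u, .ctx C⟩, ⟨v, .tree t⟩}
  | erase {A : G.N₁} {u : Form Δ G.N₀ G.N₁} (h : (A, u) ∈ G.rules₁) (v : Form Δ G.N₀ G.N₁)
      (t : Tree Δ) : Inference G (.nt₁ A v) (.tree t) {⟨u, .tree t⟩}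
  | hole : Inference G .x (.ctx .hole) ∅
  | ctxNode (f : Δ.Op) (φs : Fin (Δ.rank f) → Form Δ G.N₀ G.N₁) (i : Fin (Δ.rank f))
      (ts : {j : Fin (Δ.rank f) // j ≠ i} → Tree Δ) (C : Ctx Δ) :
      Inference G (.node f φs) (.ctx (.node f i ts C))
        (insert ⟨φs i, .ctx C⟩ (Set.range fun j => ⟨φs j.1, .tree (ts j)⟩))
  | comp {A : G.N₁} {u : Form Δ G.N₀ G.N₁} (h : (A, u) ∈ G.rules₁) (v : Form Δ G.N₀ G.N₁)
      (C D : Ctx Δ) : Inference G (.nt₁ A v) (.ctx (C.comp D)) {⟨u, .ctx C⟩, ⟨v, .ctx D⟩}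

/-- Big-step semantics: `G.Der φ (.tree t)` means that the form `φ` derives the tree `t`, whatever
is substituted for the variable, and `G.Der φ (.ctx C)` that it derives the context `C`, with the
variable in the hole. -/
inductive Der (G : LMCFTG Δ) : Form Δ G.N₀ G.N₁ → {b : Bool} → Val Δ b → Prop
  | infer {φ : Form Δ G.N₀ G.N₁} {b : Bool} {v : Val Δ b} {P : Set G.Judgment}
      (h : G.Inference φ v P) (hP : ∀ q ∈ P, Der G q.form q.val) : Der G φ v

section Soundness

theorem reflTransGen_node (f : Δ.Op) {φs ψs : Fin (Δ.rank f) → Form Δ G.N₀ G.N₁}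
    (h : ∀ j, Relation.ReflTransGen G.Step (φs j) (ψs j)) :
    Relation.ReflTransGen G.Step (.node f φs) (.node f ψs) := by
  suffices ∀ S : Finset (Fin (Δ.rank f)),
      Relation.ReflTransGen G.Step (.node f φs) (.node f (S.piecewise ψs φs)) by
    simpa using this Finset.univ
  intro S
  induction S using Finset.induction_on with
  | empty => simpa using Relation.ReflTransGen.refl
  | insert i S hi ih =>
    have hstep : Relation.ReflTransGen G.Step
        (.node f (Function.update (S.piecewise ψs φs) i (φs i)))
        (.node f (Function.update (S.piecewise ψs φs) i (ψs i))) := by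
      refine (h i).lift (fun u => Form.node f (Function.update (S.piecewise ψs φs) i u))
        fun u v huv => ?_
      simpa using Step.node f (Function.update (S.piecewise ψs φs) i u) i (by simpa using huv)
    rw [Finset.piecewise_insert]
    refine ih.trans ?_
    rwa [← Finset.piecewise_eq_of_notMem S ψs φs hi, Function.update_eq_self] at hstep

theorem Der.sound {φ : Form Δ G.N₀ G.N₁} {b : Bool} {v : Val Δ b} (h : G.Der φ v) :
    match v with
    | .tree t => ∀ s, Relation.ReflTransGen G.Step (.subst s φ) (.ofTree t)
    | .ctx C => ∀ s t, Relation.ReflTransGen G.Step s (.ofTree t) →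
        Relation.ReflTransGen G.Step (.subst s φ) (.ofTree (C.plug t)) := by
  induction h with
  | infer h _ ih =>
    cases h with
    | node f φs ts => exact fun s => reflTransGen_node f fun j => ih _ ⟨j, rfl⟩ s
    | @nt₀ A u h t =>
      refine fun s => .head (Step.rule₀ h) ?_
      simpa only [Form.subst_of_occ_eq_zero s u (G.closed _ h)] using ih _ rfl s
    | plug h v C t =>
      exact fun s => .head (Step.rule₁ h _) (ih _ (.inl rfl) _ _ (ih _ (.inr rfl) s))
    | erase h v t => exact fun s => .head (Step.rule₁ h _) (ih _ rfl _)
    | hole => exact fun s t hs => hs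
    | ctxNode f φs i ts C =>
      refine fun s t hs => reflTransGen_node f fun j => ?_
      rcases eq_or_ne j i with rfl | hj
      · simpa using ih _ (.inl rfl) s t hs
      · simpa [hj] using ih _ (.inr ⟨⟨j, hj⟩, rfl⟩) s
    | comp h v C D =>
      intro s t hs
      rw [Ctx.plug_comp]
      exact .head (Step.rule₁ h _) (ih _ (.inl rfl) _ _ (ih _ (.inr rfl) s t hs))

end Soundness

section Completeness

theorem Der.occ_pos {φ : Form Δ G.N₀ G.N₁} {b : Bool} {v : Val Δ b} (h : G.Der φ v)
    (hb : b = true) : 0 < φ.occ := by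
  induction h with
  | infer h _ ih =>
    cases h with
    | hole => exact Nat.one_pos
    | ctxNode f φs i ts C =>
      exact (ih _ (.inl rfl) rfl).trans_le (Finset.single_le_sum (f := fun j => (φs j).occ)
        (fun _ _ => Nat.zero_le _) (Finset.mem_univ i))
    | comp h v C D => exact ih _ (.inr rfl) rfl
    | _ => cases hb

theorem Der.of_subst_node {s : Form Δ G.N₀ G.N₁} {f : Δ.Op}
    {φs : Fin (Δ.rank f) → Form Δ G.N₀ G.N₁} {ts : Fin (Δ.rank f) → Tree Δ}
    (hocc : (Form.node f φs).occ ≤ 1)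
    (h : ∀ j, G.Der (.subst s (φs j)) (.tree (ts j))) {i : Fin (Δ.rank f)} {C : Ctx Δ} {t : Tree Δ}
    (hC : G.Der (φs i) (.ctx C)) (ht : ts i = C.plug t) :
    ∃ D, G.Der (.node f φs) (.ctx D) ∧ Tree.node f ts = D.plug t := by
  refine ⟨.node f i (fun j => ts j) C, .infer (.ctxNode f φs i _ C) ?_, ?_⟩
  · rintro _ (rfl | ⟨j, rfl⟩)
    · exact hC
    · have hj := Form.occ_eq_zero_of_ne hocc j.2 (hC.occ_pos rfl)
      have := h j
      rwa [Form.subst_of_occ_eq_zero _ _ hj] at this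
  · simp only [Ctx.plug, Tree.node.injEq, heq_eq_eq, true_and]
    grind

theorem Der.of_subst {s u : Form Δ G.N₀ G.N₁} (hu : u.occ ≤ 1) {t : Tree Δ}
    (h : G.Der (.subst s u) (.tree t)) :
    G.Der u (.tree t) ∨ ∃ C t', G.Der u (.ctx C) ∧ G.Der s (.tree t') ∧ t = C.plug t' := by
  induction u generalizing t with
  | x => exact .inr ⟨.hole, t, .infer .hole (by simp), h, rfl⟩
  | node f φs ih =>
    obtain ⟨⟨_, _, ts⟩, h⟩ := h
    have h (j : Fin (Δ.rank f)) : G.Der (.subst s (φs j)) (.tree (ts j)) := h _ ⟨j, rfl⟩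
    have hle (j : Fin (Δ.rank f)) : (φs j).occ ≤ 1 :=
      (Finset.single_le_sum (f := fun j => (φs j).occ)
        (fun _ _ => Nat.zero_le _) (Finset.mem_univ j)).trans hu
    by_cases hall : ∀ j, G.Der (φs j) (.tree (ts j))
    · exact .inl (.infer (.node f φs ts) (Set.forall_mem_range.mpr hall))
    · push Not at hall
      obtain ⟨i, hi⟩ := hall
      obtain ⟨C, t', hC, ht', hti⟩ := (ih i (hle i) (h i)).resolve_left hi
      obtain ⟨D, hD, ht⟩ := Der.of_subst_node hu h hC hti
      exact .inr ⟨D, t', hD, ht', ht⟩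
  | nt₀ A => exact .inl h
  | nt₁ A v ih =>
    obtain ⟨h, hP⟩ := h
    cases h with
    | plug h _ C t =>
      have hC : G.Der _ (.ctx C) := hP _ (.inl rfl)
      rcases ih hu (hP _ (.inr rfl)) with hv | ⟨D, t', hD, ht', rfl⟩
      · exact .inl (.infer (.plug h v C t) (by simp [hC, hv]))
      · exact .inr ⟨_, t', .infer (.comp h v C D) (by simp [hC, hD]), ht',
          (Ctx.plug_comp _ _ _).symm⟩
    | erase h _ t => exact .inl (.infer (.erase h v t) hP)

theorem Der.of_step {φ ψ : Form Δ G.N₀ G.N₁} (hs : G.Step φ ψ) {t : Tree Δ}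
    (h : G.Der ψ (.tree t)) : G.Der φ (.tree t) := by
  induction hs generalizing t with
  | rule₀ hr => exact .infer (.nt₀ hr t) (by simp [h])
  | rule₁ hr s =>
    rcases Der.of_subst (G.linear _ hr) h with h | ⟨C, t', hC, ht', rfl⟩
    · exact .infer (.erase hr s t) (by simp [h])
    · exact .infer (.plug hr s C t') (by simp [hC, ht'])
  | node f φs i _ ih =>
    obtain ⟨⟨_, _, ts⟩, h⟩ := h
    refine .infer (.node f φs ts) (Set.forall_mem_range.mpr fun j => ?_)
    have hj := h _ ⟨j, rfl⟩
    rcases eq_or_ne j i with rfl | hji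
    · simp only [Function.update_self] at hj
      exact ih hj
    · simpa only [Function.update_of_ne hji] using hj
  | nt₁ A _ ih =>
    obtain ⟨h, hP⟩ := h
    cases h with
    | plug h _ C t =>
      have hC : G.Der _ (.ctx C) := hP _ (.inl rfl)
      exact .infer (.plug h _ C t) (by simp [hC, ih (hP _ (.inr rfl))])
    | erase h _ t => exact .infer (.erase h _ t) hP

theorem Der.ofTree (t : Tree Δ) : G.Der (.ofTree t) (.tree t) := by
  induction t with
  | node f ts ih => exact .infer (.node f _ ts) (Set.forall_mem_range.mpr ih)

theorem Der.of_reflTransGen {φ : Form Δ G.N₀ G.N₁} {t : Tree Δ}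
    (h : Relation.ReflTransGen G.Step φ (.ofTree t)) : G.Der φ (.tree t) := by
  induction h using Relation.ReflTransGen.head_induction_on with
  | refl => exact .ofTree t
  | head hs _ ih => exact ih.of_step hs

end Completeness

theorem mem_language_iff {t : Tree Δ} : t ∈ G.language ↔ G.Der (.nt₀ G.start) (.tree t) :=
  ⟨.of_reflTransGen, fun h => h.sound .x⟩

/-! ## The pumping lemma -/

section Lifts

/-- `Lifts ψ φ F`: a derivation of `F w` from `φ` is obtained by using a derivation of `w` from `ψ`
once, and `w` occurs in `F w`. -/
structure Lifts (ψ φ : Form Δ G.N₀ G.N₁) {b b' : Bool} (F : Val Δ b → Val Δ b') : Prop where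
  der : ∀ w, G.Der ψ w → G.Der φ (F w)
  fill : ∀ s, ∃ K s', ∀ w, (F w).fill s = Ctx.plug K (w.fill s')

theorem Lifts.refl (φ : Form Δ G.N₀ G.N₁) (b : Bool) : Lifts φ φ (id : Val Δ b → Val Δ b) where
  der _ h := h
  fill s := ⟨.hole, s, fun _ => rfl⟩

theorem Lifts.comp {φ ψ χ : Form Δ G.N₀ G.N₁} {b b' b'' : Bool} {F : Val Δ b' → Val Δ b''}
    {F' : Val Δ b → Val Δ b'} (h : Lifts ψ χ F) (h' : Lifts φ ψ F') : Lifts φ χ (F ∘ F') where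
  der w hw := h.der _ (h'.der w hw)
  fill s := by
    obtain ⟨K, s', hK⟩ := h.fill s
    obtain ⟨K', s'', hK'⟩ := h'.fill s'
    exact ⟨K.comp K', s'', fun w => by rw [Function.comp, hK, hK', Ctx.plug_comp]⟩

theorem Inference.exists_lifts_tree {φ : Form Δ G.N₀ G.N₁} {t : Tree Δ} {P : Set G.Judgment}
    (h : G.Inference φ (.tree t) P) (hP : ∀ q ∈ P, G.Der q.form q.val) {q : G.Judgment}
    (hq : q ∈ P) : ∃ F : Val Δ q.b → Val Δ false, F q.val = .tree t ∧ Lifts q.form φ F := by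
  cases h with
  | node f φs ts =>
    obtain ⟨i, rfl⟩ := hq
    refine ⟨fun | .tree r => .tree (.node f (Function.update ts i r)), by simp, ?_, fun s =>
      ⟨.node f i (fun j => ts j) .hole, s, fun | .tree r => Ctx.node_update_eq_plug f ts i r⟩⟩
    rintro ⟨r⟩ hr
    refine .infer (.node f φs _) (Set.forall_mem_range.mpr ?_)
    exact (Function.forall_update_iff ts fun j t => G.Der (φs j) (.tree t)).mpr
      ⟨hr, fun j _ => hP _ ⟨j, rfl⟩⟩
  | nt₀ h =>
    subst hq
    exact ⟨id, rfl, fun | .tree r, hr => .infer (.nt₀ h r) (by simpa using hr),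
      fun s => ⟨.hole, s, fun _ => rfl⟩⟩
  | plug h v C t =>
    rcases hq with rfl | rfl
    · have hv : G.Der v (.tree t) := hP _ (.inr rfl)
      exact ⟨fun | .ctx D => .tree (D.plug t), rfl,
        fun | .ctx D, hD => .infer (.plug h v D t) (by simpa [hv] using hD),
        fun _ => ⟨.hole, t, fun | .ctx D => rfl⟩⟩
    · have hC : G.Der _ (.ctx C) := hP _ (.inl rfl)
      exact ⟨fun | .tree r => .tree (C.plug r), rfl,
        fun | .tree r, hr => .infer (.plug h v C r) (by simpa [hC] using hr),
        fun s => ⟨C, s, fun | .tree r => rfl⟩⟩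
  | erase h v t =>
    subst hq
    exact ⟨id, rfl, fun | .tree r, hr => .infer (.erase h v r) (by simpa using hr),
      fun s => ⟨.hole, s, fun _ => rfl⟩⟩

theorem Inference.exists_lifts_ctx {φ : Form Δ G.N₀ G.N₁} {C : Ctx Δ} {P : Set G.Judgment}
    (h : G.Inference φ (.ctx C) P) (hP : ∀ q ∈ P, G.Der q.form q.val) {q : G.Judgment}
    (hq : q ∈ P) : ∃ F : Val Δ q.b → Val Δ true, F q.val = .ctx C ∧ Lifts q.form φ F := by
  cases h with
  | hole => cases hq
  | ctxNode f φs i ts C =>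
    rcases hq with rfl | ⟨j, rfl⟩
    · refine ⟨fun | .ctx D => .ctx (.node f i ts D), rfl, ?_, fun s =>
        ⟨.node f i ts .hole, s, fun | .ctx D => rfl⟩⟩
      rintro ⟨D⟩ hD
      exact .infer (.ctxNode f φs i ts _)
        (Set.forall_mem_insert.mpr ⟨hD, fun q hq => hP q (.inr hq)⟩)
    · refine ⟨fun | .tree r => .ctx (.node f i (Function.update ts j r) C), by simp, ?_, fun s =>
        ⟨_, s, fun | .tree r => Ctx.plug_node_update ts C j s r⟩⟩
      rintro ⟨r⟩ hr
      refine .infer (.ctxNode f φs i _ C)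
        (Set.forall_mem_insert.mpr ⟨hP _ (.inl rfl), Set.forall_mem_range.mpr ?_⟩)
      exact (Function.forall_update_iff ts fun k t => G.Der (φs k) (.tree t)).mpr
        ⟨hr, fun k _ => hP _ (.inr ⟨k, rfl⟩)⟩
  | comp h v C D =>
    rcases hq with rfl | rfl
    · have hD : G.Der v (.ctx D) := hP _ (.inr rfl)
      exact ⟨fun | .ctx C' => .ctx (C'.comp D), rfl,
        fun | .ctx C', hC' => .infer (.comp h v C' D) (by simpa [hD] using hC'),
        fun s => ⟨.hole, D.plug s, fun | .ctx C' => Ctx.plug_comp C' D s⟩⟩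
    · have hC : G.Der _ (.ctx C) := hP _ (.inl rfl)
      exact ⟨fun | .ctx D' => .ctx (C.comp D'), rfl,
        fun | .ctx D', hD' => .infer (.comp h v C D') (by simpa [hC] using hD'),
        fun s => ⟨C, s, fun | .ctx D' => Ctx.plug_comp C D' s⟩⟩

theorem Inference.exists_lifts {φ : Form Δ G.N₀ G.N₁} {b : Bool} {v : Val Δ b}
    {P : Set G.Judgment} (h : G.Inference φ v P) (hP : ∀ q ∈ P, G.Der q.form q.val)
    {q : G.Judgment} (hq : q ∈ P) :
    ∃ F : Val Δ q.b → Val Δ b, F q.val = v ∧ Lifts q.form φ F := by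
  cases v with
  | tree t => exact h.exists_lifts_tree hP hq
  | ctx C => exact h.exists_lifts_ctx hP hq

theorem Inference.exists_comp {φ ψ : Form Δ G.N₀ G.N₁} {C D : Ctx Δ} {P : Set G.Judgment}
    (h : G.Inference φ (.ctx C) P) (hP : ∀ q ∈ P, G.Der q.form q.val)
    (hq : (⟨ψ, .ctx D⟩ : G.Judgment) ∈ P) : ∃ C₂ C₄ : Ctx Δ, C = C₂.comp (D.comp C₄) ∧
      ∀ D', G.Der ψ (.ctx D') → G.Der φ (.ctx (C₂.comp (D'.comp C₄))) := by
  cases h with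
  | hole => cases hq
  | ctxNode f φs i ts C =>
    rcases hq with hq | ⟨j, hj⟩
    · cases hq
      refine ⟨.node f i ts .hole, .hole, by simp [Ctx.comp], fun D' hD' => ?_⟩
      exact .infer (.ctxNode f φs i ts _)
        (Set.forall_mem_insert.mpr ⟨by simpa [Ctx.comp] using hD', fun q hq => hP q (.inr hq)⟩)
    · cases hj
  | comp h v C D =>
    rcases hq with hq | hq <;> cases hq
    · have hD : G.Der v (.ctx D) := hP _ (.inr rfl)
      exact ⟨.hole, D, rfl, fun D' hD' => .infer (.comp h v D' D) (by simpa [hD] using hD')⟩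
    · have hC : G.Der _ (.ctx C) := hP _ (.inl rfl)
      exact ⟨C, .hole, by simp, fun D' hD' => .infer (.comp h _ C _) (by simpa [hC] using hD')⟩

end Lifts

section Pumping

open scoped Classical in
/-- A derivation in which no form derives two trees on a path, nor two contexts on the path from the
root of a context to its hole.  The forms in `S` may still derive trees, and those in `U` may still
derive contexts on the current path; a tree that branches off starts again with `W` for `U`. -/
inductive RepeatFree (W : Finset (Form Δ G.N₀ G.N₁)) :
    Finset (Form Δ G.N₀ G.N₁) → Finset (Form Δ G.N₀ G.N₁) →
      Form Δ G.N₀ G.N₁ → {b : Bool} → Val Δ b → Prop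
  | tree {S U : Finset (Form Δ G.N₀ G.N₁)} {φ : Form Δ G.N₀ G.N₁} {t : Tree Δ}
      {P : Set G.Judgment} (hφ : φ ∈ S) (h : G.Inference φ (.tree t) P)
      (hP : ∀ q ∈ P, RepeatFree W (S.erase φ) W q.form q.val) : RepeatFree W S U φ (.tree t)
  | ctx {S U : Finset (Form Δ G.N₀ G.N₁)} {φ : Form Δ G.N₀ G.N₁} {C : Ctx Δ}
      {P : Set G.Judgment} (hφ : φ ∈ U) (h : G.Inference φ (.ctx C) P)
      (hP : ∀ q ∈ P, RepeatFree W S (U.erase φ) q.form q.val) : RepeatFree W S U φ (.ctx C)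

variable {W S U : Finset (Form Δ G.N₀ G.N₁)} {φ : Form Δ G.N₀ G.N₁} {b : Bool} {v : Val Δ b}
  {P : Set G.Judgment} {p : ℕ}

namespace RepeatFree

theorem der (h : RepeatFree W S U φ v) : G.Der φ v := by
  induction h with
  | tree _ h _ ih | ctx _ h _ ih => exact .infer h ih

theorem mono (h : RepeatFree W S U φ v) {S' U' : Finset (Form Δ G.N₀ G.N₁)} (hS : S ⊆ S')
    (hU : U ⊆ U') : RepeatFree W S' U' φ v := by
  classical
  induction h generalizing S' U' with
  | tree hφ h _ ih =>
    exact .tree (hS hφ) h fun q hq => ih q hq (Finset.erase_subset_erase _ hS) subset_rfl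
  | ctx hφ h _ ih =>
    exact .ctx (hU hφ) h fun q hq => ih q hq hS (Finset.erase_subset_erase _ hU)

theorem of_tree {t : Tree Δ} (h : RepeatFree W S U φ (.tree t))
    (U' : Finset (Form Δ G.N₀ G.N₁)) : RepeatFree W S U' φ (.tree t) := by
  cases h with
  | tree hφ h hP => exact .tree hφ h hP

end RepeatFree

theorem Inference.height_le (h : G.Inference φ v P) {n : ℕ} (hP : ∀ q ∈ P, q.val.height ≤ n) :
    v.height ≤ 2 * n + 1 := by
  cases h with
  | node f φs ts =>
    have := Finset.sup_le (s := Finset.univ) fun j _ => hP _ ⟨j, rfl⟩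
    simp only [Val.height, Tree.height] at this ⊢
    omega
  | nt₀ h t | erase h _ t => exact (hP _ rfl).trans (by omega)
  | plug h _ C t =>
    have h₁ := hP _ (.inl rfl)
    have h₂ := hP _ (.inr rfl)
    have h₃ := C.height_plug_le t
    simp only [Val.height] at h₁ h₂ ⊢
    omega
  | hole => exact Nat.zero_le _
  | ctxNode f φs i ts C =>
    have h₁ := hP _ (.inl rfl)
    have h₂ := Finset.sup_le (s := Finset.univ) fun j _ => hP _ (.inr ⟨j, rfl⟩)
    simp only [Val.height, Ctx.height] at h₁ h₂ ⊢
    omega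
  | comp h _ C D =>
    have h₁ := hP _ (.inl rfl)
    have h₂ := hP _ (.inr rfl)
    have h₃ := C.height_comp_le D
    simp only [Val.height] at h₁ h₂ ⊢
    omega

theorem Inference.height_lt_two_pow (h : G.Inference φ v P) {n : ℕ}
    (hP : ∀ q ∈ P, q.val.height < 2 ^ n) : v.height < 2 ^ (n + 1) := by
  have := Nat.two_pow_pos n
  have := h.height_le (n := 2 ^ n - 1) fun q hq => Nat.le_sub_one_of_lt (hP q hq)
  omega

namespace RepeatFree

theorem height_lt (h : RepeatFree W S U φ v) :
    v.height < 2 ^ (S.card * (W.card + 1) + U.card) := by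
  classical
  induction h with
  | @tree S U φ t P hφ h _ ih =>
    refine (h.height_lt_two_pow ih).trans_le (Nat.pow_le_pow_right two_pos ?_)
    rw [Finset.card_erase_of_mem hφ, Nat.add_assoc, ← Nat.succ_mul, Nat.succ_eq_add_one,
      Nat.sub_add_cancel (Finset.card_pos.mpr ⟨φ, hφ⟩)]
    exact Nat.le_add_right _ _
  | @ctx S U φ C P hφ h _ ih =>
    have := h.height_lt_two_pow ih
    rwa [Finset.card_erase_of_mem hφ, Nat.add_assoc,
      Nat.sub_add_cancel (Finset.card_pos.mpr ⟨φ, hφ⟩)] at this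

open scoped Classical in
theorem erase_or_tree (ψ : Form Δ G.N₀ G.N₁) (h : RepeatFree W S U φ v) :
    RepeatFree W (S.erase ψ) U φ v ∨ ∃ (r : Tree Δ) (F : Val Δ false → Val Δ b),
      F (.tree r) = v ∧ RepeatFree W S W ψ (.tree r) ∧ Lifts ψ φ F := by
  induction h with
  | @tree S U φ t P hφ h hP ih =>
    rcases eq_or_ne φ ψ with rfl | hne
    · exact .inr ⟨t, id, rfl, .tree hφ h hP, .refl φ false⟩
    by_cases hall : ∀ q ∈ P, RepeatFree W ((S.erase φ).erase ψ) W q.form q.val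
    · rw [Finset.erase_right_comm] at hall
      exact .inl (.tree (Finset.mem_erase.mpr ⟨hne, hφ⟩) h hall)
    push Not at hall
    obtain ⟨q, hq, hnot⟩ := hall
    obtain ⟨r, F, hF, hr, hlift⟩ := (ih q hq).resolve_left hnot
    obtain ⟨F', hF', hlift'⟩ := h.exists_lifts (fun q hq => (hP q hq).der) hq
    exact .inr ⟨r, F' ∘ F, by rw [Function.comp, hF, hF'],
      hr.mono (Finset.erase_subset _ _) subset_rfl, hlift'.comp hlift⟩
  | @ctx S U φ C P hφ h hP ih =>
    by_cases hall : ∀ q ∈ P, RepeatFree W (S.erase ψ) (U.erase φ) q.form q.val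
    · exact .inl (.ctx hφ h hall)
    push Not at hall
    obtain ⟨q, hq, hnot⟩ := hall
    obtain ⟨r, F, hF, hr, hlift⟩ := (ih q hq).resolve_left hnot
    obtain ⟨F', hF', hlift'⟩ := h.exists_lifts (fun q hq => (hP q hq).der) hq
    exact .inr ⟨r, F' ∘ F, by rw [Function.comp, hF, hF'], hr, hlift'.comp hlift⟩

open scoped Classical in
theorem erase_or_ctx (ψ : Form Δ G.N₀ G.N₁) (h : RepeatFree W S U φ v) {C : Ctx Δ}
    (hv : (⟨φ, v⟩ : G.Judgment) = ⟨φ, .ctx C⟩) :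
    RepeatFree W S (U.erase ψ) φ (.ctx C) ∨ ∃ C₂ C₃ C₄ : Ctx Δ, C = C₂.comp (C₃.comp C₄) ∧
      RepeatFree W S U ψ (.ctx C₃) ∧
      ∀ D, G.Der ψ (.ctx D) → G.Der φ (.ctx (C₂.comp (D.comp C₄))) := by
  induction h generalizing C with
  | tree => cases hv
  | @ctx S U φ C P hφ h hP ih =>
    cases hv
    rcases eq_or_ne φ ψ with rfl | hne
    · exact .inr ⟨.hole, C, .hole, by simp [Ctx.comp], .ctx hφ h hP, by simp [Ctx.comp]⟩
    by_cases hall : ∀ q ∈ P, RepeatFree W S ((U.erase φ).erase ψ) q.form q.val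
    · rw [Finset.erase_right_comm] at hall
      exact .inl (.ctx (Finset.mem_erase.mpr ⟨hne, hφ⟩) h hall)
    push Not at hall
    obtain ⟨⟨χ, w⟩, hq, hnot⟩ := hall
    cases w with
    | tree t => exact absurd ((hP _ hq).of_tree _) hnot
    | ctx D =>
      obtain ⟨C₂, C₃, C₄, rfl, hr, hder⟩ := (ih _ hq rfl).resolve_left hnot
      obtain ⟨D₂, D₄, rfl, hder'⟩ := h.exists_comp (fun q hq => (hP q hq).der) hq
      exact .inr ⟨D₂.comp C₂, C₃, C₄.comp D₄, by simp only [Ctx.comp_assoc],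
        hr.mono subset_rfl (Finset.erase_subset _ _),
        fun E hE => by simpa only [Ctx.comp_assoc] using hder' _ (hder E hE)⟩

end RepeatFree

/-- A family of trees that is obtained by pumping contexts of bounded height. -/
def IsPumpFamily (p : ℕ) (τ : ℕ → Tree Δ) : Prop :=
  ∃ (C₁ C₂ C₃ C₄ : Ctx Δ) (t₅ : Tree Δ), (∀ i, τ i = C₁.plug ((Ctx.pump C₂ C₃ C₄ i).plug t₅)) ∧
    (C₂.comp (C₃.comp C₄)).height ≤ p ∧ 0 < C₂.height + C₄.height

theorem IsPumpFamily.plug {τ : ℕ → Tree Δ} (h : IsPumpFamily p τ) (K : Ctx Δ) :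
    IsPumpFamily p fun i => K.plug (τ i) := by
  obtain ⟨C₁, C₂, C₃, C₄, t₅, hτ, h⟩ := h
  exact ⟨K.comp C₁, C₂, C₃, C₄, t₅, fun i => by simp only [hτ, Ctx.plug_comp], h⟩

/-- `v` is the member with index 1 of a family of values derived by `φ` and obtained by pumping. -/
def Pumpable (p : ℕ) (φ : Form Δ G.N₀ G.N₁) (v : Val Δ b) : Prop :=
  ∃ τ : ℕ → Val Δ b, τ 1 = v ∧ (∀ s, IsPumpFamily p fun i => (τ i).fill s) ∧ ∀ i, G.Der φ (τ i)

theorem Pumpable.lift {ψ : Form Δ G.N₀ G.N₁} {b' : Bool} {F : Val Δ b → Val Δ b'}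
    (h : Pumpable p ψ v) (hF : Lifts ψ φ F) : Pumpable p φ (F v) := by
  obtain ⟨τ, rfl, hτ, hder⟩ := h
  refine ⟨F ∘ τ, rfl, fun s => ?_, fun i => hF.der _ (hder i)⟩
  obtain ⟨K, s', hK⟩ := hF.fill s
  simpa only [Function.comp, hK] using (hτ s').plug K

theorem RepeatFree.or_pumpable_tree {K : Ctx Δ} {r : Tree Δ}
    (hr : RepeatFree W S U φ (.tree r)) (hp : (K.plug r).height ≤ p)
    (hK : ∀ r', G.Der φ (.tree r') → G.Der φ (.tree (K.plug r'))) :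
    RepeatFree W S U φ (.tree (K.plug r)) ∨ Pumpable p φ (.tree (K.plug r)) := by
  rcases Nat.eq_zero_or_pos K.height with h0 | h0
  · rw [Ctx.eq_hole h0]
    exact .inl hr
  · refine .inr ⟨fun i => .tree ((Ctx.pump K .hole .hole i).plug r), by simp [Ctx.pump],
      fun s => ⟨.hole, K, .hole, .hole, r, fun i => rfl, ?_, Nat.add_pos_left h0 _⟩, fun i => ?_⟩
    · simpa using (K.height_le_plug r).trans hp
    · induction i with
      | zero => exact hr.der
      | succ i ih => simpa [Ctx.pump, Ctx.plug_comp] using hK _ ih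

theorem RepeatFree.or_pumpable_ctx {C₂ C₃ C₄ : Ctx Δ} (hr : RepeatFree W S U φ (.ctx C₃))
    (hp : (C₂.comp (C₃.comp C₄)).height ≤ p)
    (hC : ∀ D, G.Der φ (.ctx D) → G.Der φ (.ctx (C₂.comp (D.comp C₄)))) :
    RepeatFree W S U φ (.ctx (C₂.comp (C₃.comp C₄))) ∨
      Pumpable p φ (.ctx (C₂.comp (C₃.comp C₄))) := by
  rcases Nat.eq_zero_or_pos (C₂.height + C₄.height) with h0 | h0
  · rw [Ctx.eq_hole (Nat.eq_zero_of_add_eq_zero_right h0),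
      Ctx.eq_hole (Nat.eq_zero_of_add_eq_zero_left h0)]
    simpa using .inl hr
  · refine .inr ⟨fun i => .ctx (Ctx.pump C₂ C₃ C₄ i), rfl,
      fun s => ⟨.hole, C₂, C₃, C₄, s, fun i => rfl, hp, h0⟩, fun i => ?_⟩
    induction i with
    | zero => exact hr.der
    | succ i ih => exact hC _ ih

theorem Inference.repeatFree_or_pumpable_tree {t : Tree Δ} (h : G.Inference φ (.tree t) P)
    (hφ : φ ∈ W) (hP : ∀ q ∈ P, RepeatFree W W W q.form q.val) (hp : t.height ≤ p) :
    RepeatFree W W W φ (.tree t) ∨ Pumpable p φ (.tree t) := by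
  classical
  by_cases hall : ∀ q ∈ P, RepeatFree W (W.erase φ) W q.form q.val
  · exact .inl (.tree hφ h hall)
  push Not at hall
  obtain ⟨q, hq, hnot⟩ := hall
  obtain ⟨r, F, hF, hr, hlift⟩ := ((hP q hq).erase_or_tree φ).resolve_left hnot
  obtain ⟨F', hF', hlift'⟩ := h.exists_lifts (fun q hq => (hP q hq).der) hq
  have hlift := hlift'.comp hlift
  obtain ⟨K, s, hK⟩ := hlift.fill t
  have hval (r' : Tree Δ) : (F' ∘ F) (.tree r') = .tree (K.plug r') :=
    (Val.tree_fill _ t).symm.trans (congrArg _ (hK (.tree r')))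
  obtain rfl : K.plug r = t := by simpa [hF, hF'] using (hval r).symm
  exact hr.or_pumpable_tree hp fun r' hr' => by simpa only [hval] using hlift.der _ hr'

theorem Inference.repeatFree_or_pumpable_ctx {C : Ctx Δ} (h : G.Inference φ (.ctx C) P)
    (hφ : φ ∈ W) (hP : ∀ q ∈ P, RepeatFree W W W q.form q.val) (hp : C.height ≤ p) :
    RepeatFree W W W φ (.ctx C) ∨ Pumpable p φ (.ctx C) := by
  classical
  by_cases hall : ∀ q ∈ P, RepeatFree W W (W.erase φ) q.form q.val
  · exact .inl (.ctx hφ h hall)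
  push Not at hall
  obtain ⟨⟨χ, w⟩, hq, hnot⟩ := hall
  cases w with
  | tree t => exact absurd ((hP _ hq).of_tree _) hnot
  | ctx D =>
    obtain ⟨C₂, C₃, C₄, rfl, hr, hder⟩ := ((hP _ hq).erase_or_ctx φ rfl).resolve_left hnot
    obtain ⟨D₂, D₄, rfl, hder'⟩ := h.exists_comp (fun q hq => (hP q hq).der) hq
    have heq (E : Ctx Δ) : D₂.comp ((C₂.comp (E.comp C₄)).comp D₄) =
        (D₂.comp C₂).comp (E.comp (C₄.comp D₄)) := by
      simp only [Ctx.comp_assoc]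
    rw [heq] at hp ⊢
    exact hr.or_pumpable_ctx hp fun E hE => heq E ▸ hder' _ (hder E hE)

theorem Der.repeatFree_or_pumpable
    (hW : ∀ {φ : Form Δ G.N₀ G.N₁} {b : Bool} {v : Val Δ b} {P : Set G.Judgment}, φ ∈ W →
      G.Inference φ v P → ∀ q ∈ P, q.form ∈ W)
    (h : G.Der φ v) (hφ : φ ∈ W) :
    RepeatFree W W W φ v ∨ Pumpable (2 ^ (W.card * (W.card + 1) + W.card + 1)) φ v := by
  induction h with
  | @infer φ b v P h hP ih =>
    by_cases hall : ∀ q ∈ P, RepeatFree W W W q.form q.val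
    · have hp := (h.height_lt_two_pow fun q hq => (hall q hq).height_lt).le
      cases v with
      | tree t => exact h.repeatFree_or_pumpable_tree hφ hall hp
      | ctx C => exact h.repeatFree_or_pumpable_ctx hφ hall hp
    · push Not at hall
      obtain ⟨q, hq, hnot⟩ := hall
      obtain ⟨F, rfl, hF⟩ := h.exists_lifts hP hq
      exact .inr (((ih q hq (hW hφ h q hq)).resolve_left hnot).lift hF)

end Pumping

theorem exists_finset_closed (G : LMCFTG Δ) : ∃ W : Finset (Form Δ G.N₀ G.N₁),
    .nt₀ G.start ∈ W ∧ ∀ {φ : Form Δ G.N₀ G.N₁} {b : Bool} {v : Val Δ b} {P : Set G.Judgment},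
      φ ∈ W → G.Inference φ v P → ∀ q ∈ P, q.form ∈ W := by
  let rhs : Set (Form Δ G.N₀ G.N₁) := Prod.snd '' G.rules₀ ∪ Prod.snd '' G.rules₁
  have hrhs : rhs.Finite := (G.fin₀.image _).union (G.fin₁.image _)
  obtain ⟨W, hW⟩ :=
    ((hrhs.biUnion fun u _ => u.finite_subforms).insert (.nt₀ G.start)).exists_finset
  simp only [Set.mem_insert_iff, Set.mem_iUnion₂] at hW
  have hsub {φ ψ : Form Δ G.N₀ G.N₁} (hφ : φ ∈ W) (hψ : ψ ∈ φ.subforms) : ψ ∈ W := by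
    rcases (hW φ).mp hφ with rfl | ⟨u, hu, h⟩
    · rwa [Set.mem_singleton_iff.mp hψ]
    · exact (hW ψ).mpr (.inr ⟨u, hu, Form.subforms_subset h hψ⟩)
  have hrule {u : Form Δ G.N₀ G.N₁} (hu : u ∈ rhs) : u ∈ W :=
    (hW u).mpr (.inr ⟨u, hu, u.self_mem_subforms⟩)
  refine ⟨W, (hW _).mpr (.inl rfl), fun {φ b v P} hφ h => ?_⟩
  have harg {f : Δ.Op} {φs : Fin (Δ.rank f) → Form Δ G.N₀ G.N₁} (h : .node f φs ∈ W)
      (j : Fin (Δ.rank f)) : φs j ∈ W :=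
    hsub h (Set.mem_insert_of_mem _ (Set.mem_iUnion.mpr ⟨j, (φs j).self_mem_subforms⟩))
  cases h with
  | node => exact Set.forall_mem_range.mpr (harg hφ)
  | nt₀ h => exact fun q hq => hq ▸ hrule (.inl ⟨_, h, rfl⟩)
  | erase h => exact fun q hq => hq ▸ hrule (.inr ⟨_, h, rfl⟩)
  | plug h v | comp h v =>
    rintro _ (rfl | rfl)
    · exact hrule (.inr ⟨_, h, rfl⟩)
    · exact hsub hφ (Set.mem_insert_of_mem _ v.self_mem_subforms)
  | hole => exact fun q hq => hq.elim
  | ctxNode =>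
    exact Set.forall_mem_insert.mpr ⟨harg hφ _, Set.forall_mem_range.mpr fun j => harg hφ j⟩

theorem exists_isPumpingHeight (G : LMCFTG Δ) : ∃ p, IsPumpingHeight G.language p := by
  obtain ⟨W, hstart, hW⟩ := G.exists_finset_closed
  refine ⟨2 ^ (W.card * (W.card + 1) + W.card + 1), fun t ht hp => ?_⟩
  rcases (mem_language_iff.mp ht).repeatFree_or_pumpable hW hstart with h | ⟨τ, h1, hτ, hder⟩
  · exact absurd (h.height_lt.trans_le (Nat.pow_le_pow_right two_pos (Nat.le_succ _))) hp.not_gt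
  · obtain ⟨C₁, C₂, C₃, C₄, t₅, hτ, hheight, hpos⟩ := hτ t
    refine ⟨C₁, C₂, C₃, C₄, t₅, ?_, hheight, hpos, fun i => ?_⟩
    · refine (congrArg (Val.fill t) h1).symm.trans ((hτ 1).trans ?_)
      simp only [Ctx.pump, Ctx.plug_comp]
    · rw [← hτ i]
      exact mem_language_iff.mpr (((τ i).tree_fill t).symm ▸ hder i)

end LMCFTG

end Grammar

/-! ## Concatenations of blocks -/

section Strings

variable {L : List (Letter × ℕ)} {p s u v w m : List Token} {q z : Letter} {k : ℕ}

/-- Tests for barred letters. -/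
def Token.isBar : Token → Bool
  | .sym (.bar _) => true
  | _ => false

/-- The number of barred letters, whatever the letter. -/
def bars (s : List Token) : ℕ := s.countP Token.isBar

/-- The number of opening brackets. -/
def opens (s : List Token) : ℕ := s.count .lbr

/-- The number of closing brackets. -/
def closes (s : List Token) : ℕ := s.count .rbr

/-- Strings without unbarred letters, such as the factors inside a single block. -/
def Coreless (s : List Token) : Prop := ∀ z, Token.core z ∉ s

@[simp] theorem bars_append (s t : List Token) : bars (s ++ t) = bars s + bars t :=
  List.countP_append

@[simp] theorem opens_append (s t : List Token) : opens (s ++ t) = opens s + opens t :=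
  List.count_append

@[simp] theorem closes_append (s t : List Token) : closes (s ++ t) = closes s + closes t :=
  List.count_append

@[simp] theorem bars_core_cons (z : Letter) (s : List Token) :
    bars (Token.core z :: s) = bars s := by
  simp [bars, Token.isBar]

@[simp] theorem opens_core_cons (z : Letter) (s : List Token) :
    opens (Token.core z :: s) = opens s := by
  simp [opens]

@[simp] theorem closes_core_cons (z : Letter) (s : List Token) :
    closes (Token.core z :: s) = closes s := by
  simp [closes]

theorem count_bar_le_bars (z : Letter) (s : List Token) : s.count (Token.bar z) ≤ bars s := by
  refine List.countP_mono_left fun t _ h => ?_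
  rw [beq_iff_eq.mp h]
  rfl

theorem exists_bar_mem_of_bars_pos (h : 0 < bars s) : ∃ z, Token.bar z ∈ s := by
  obtain ⟨(z | z) | _ | _, ht, hbar⟩ := List.countP_pos_iff.mp h
  · cases hbar
  · exact ⟨z, ht⟩
  · cases hbar
  · cases hbar

theorem bars_add_opens_add_closes_le_length (s : List Token) :
    bars s + opens s + closes s ≤ s.length := by
  induction s with
  | nil => simp [bars, opens, closes]
  | cons t s ih =>
    simp only [bars, opens, closes, List.countP_cons, List.count_cons, List.length_cons] at ih ⊢
    rcases t with (z | z) | _ | _ <;> simp [Token.isBar] <;> omega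

/-- A block without its leading letter: `⟨ᵏ z̄ᵏ ⟩ᵏ`. -/
def blockTail (z : Letter) (k : ℕ) : List Token :=
  List.replicate k Token.lbr ++ List.replicate k (Token.bar z) ++ List.replicate k Token.rbr

/-- The concatenation of the blocks with the given letters and exponents. -/
def blockString (L : List (Letter × ℕ)) : List Token := L.flatMap fun q => block q.1 q.2

@[simp] theorem blockString_nil : blockString [] = [] := rfl

theorem blockString_cons (z : Letter) (k : ℕ) (L : List (Letter × ℕ)) :
    blockString ((z, k) :: L) = Token.core z :: (blockTail z k ++ blockString L) := by
  simp [blockString, block, blockTail]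

theorem blockString_append (L L' : List (Letter × ℕ)) :
    blockString (L ++ L') = blockString L ++ blockString L' :=
  List.flatMap_append

theorem coreless_blockTail (z : Letter) (k : ℕ) : Coreless (blockTail z k) := by
  simp [Coreless, blockTail, List.mem_replicate]

@[simp] theorem bars_blockTail (z : Letter) (k : ℕ) : bars (blockTail z k) = k := by
  simp [blockTail, bars, List.countP_replicate, Token.isBar]

@[simp] theorem opens_blockTail (z : Letter) (k : ℕ) : opens (blockTail z k) = k := by
  simp [blockTail, opens, List.count_replicate]

@[simp] theorem closes_blockTail (z : Letter) (k : ℕ) : closes (blockTail z k) = k := by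
  simp [blockTail, closes, List.count_replicate]

theorem count_bar_blockTail (z : Letter) (k : ℕ) : (blockTail z k).count (Token.bar z) = k := by
  simp [blockTail, List.count_replicate]

theorem eq_of_bar_mem_blockTail (h : Token.bar z ∈ blockTail q k) : z = q := by
  have : k ≠ 0 ∧ z = q := by simpa [blockTail, List.mem_replicate] using h
  exact this.2

/-- The position of a kind of token in a block; ranks are weakly increasing along a block. -/
def Token.rank : Token → ℕ
  | .sym (.core _) => 0
  | .lbr => 1
  | .sym (.bar _) => 2
  | .rbr => 3

theorem pairwise_rank_le_blockTail (z : Letter) (k : ℕ) :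
    (blockTail z k).Pairwise fun s t => s.rank ≤ t.rank := by
  simp only [blockTail, List.pairwise_append, List.pairwise_replicate, List.mem_append,
    List.mem_replicate]
  refine ⟨⟨Or.inr le_rfl, Or.inr le_rfl, ?_⟩, Or.inr le_rfl, ?_⟩
  · rintro a ⟨_, rfl⟩ b ⟨_, rfl⟩
    simp [Token.rank]
  · rintro a (⟨_, rfl⟩ | ⟨_, rfl⟩) b ⟨_, rfl⟩ <;> simp [Token.rank]

theorem bars_blockString_eq_opens (L : List (Letter × ℕ)) :
    bars (blockString L) = opens (blockString L) := by
  induction L with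
  | nil => rfl
  | cons q L ih =>
    obtain ⟨z, k⟩ := q
    simp [blockString_cons, ih]

theorem bars_blockString_eq_closes (L : List (Letter × ℕ)) :
    bars (blockString L) = closes (blockString L) := by
  induction L with
  | nil => rfl
  | cons q L ih =>
    obtain ⟨z, k⟩ := q
    simp [blockString_cons, ih]

theorem bars_le_opens_of_blockTail_eq (h : blockTail z k = p ++ s) : bars p ≤ opens p := by
  have hrank := pairwise_rank_le_blockTail z k
  have hbars := bars_blockTail z k
  have hopens := opens_blockTail z k
  rw [h] at hrank hbars hopens
  rw [bars_append] at hbars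
  rw [opens_append] at hopens
  rcases Nat.eq_zero_or_pos (bars p) with h0 | h0
  · omega
  · obtain ⟨q, hq⟩ := exists_bar_mem_of_bars_pos h0
    have : opens s = 0 := List.count_eq_zero.mpr fun hl => by
      simpa [Token.rank] using (List.pairwise_append.mp hrank).2.2 _ hq _ hl
    omega

theorem bars_le_closes_of_blockTail_eq (h : blockTail z k = p ++ s) : bars s ≤ closes s := by
  have hrank := pairwise_rank_le_blockTail z k
  have hbars := bars_blockTail z k
  have hcloses := closes_blockTail z k
  rw [h] at hrank hbars hcloses
  rw [bars_append] at hbars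
  rw [closes_append] at hcloses
  rcases Nat.eq_zero_or_pos (bars s) with h0 | h0
  · omega
  · obtain ⟨q, hq⟩ := exists_bar_mem_of_bars_pos h0
    have : closes p = 0 := List.count_eq_zero.mpr fun hl => by
      simpa [Token.rank] using (List.pairwise_append.mp hrank).2.2 _ hl _ hq
    omega

theorem bars_le_opens_of_prefix (h : blockString L = u ++ v) : bars u ≤ opens u := by
  induction L generalizing u with
  | nil =>
    obtain ⟨rfl, -⟩ := List.append_eq_nil_iff.mp h.symm
    simp [bars]
  | cons p L ih =>
    obtain ⟨z, k⟩ := p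
    rw [blockString_cons] at h
    rcases u with _ | ⟨t, u⟩
    · simp [bars]
    · rw [List.cons_append, List.cons.injEq] at h
      obtain ⟨rfl, h⟩ := h
      simp only [bars_core_cons, opens_core_cons]
      rcases List.append_eq_append_iff.mp h with ⟨a, rfl, h'⟩ | ⟨a, h', -⟩
      · simpa using ih h'
      · exact bars_le_opens_of_blockTail_eq h'

theorem bars_le_closes_of_suffix (h : blockString L = u ++ v) : bars v ≤ closes v := by
  induction L generalizing u with
  | nil =>
    obtain ⟨-, rfl⟩ := List.append_eq_nil_iff.mp h.symm
    simp [bars]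
  | cons p L ih =>
    obtain ⟨z, k⟩ := p
    rcases u with _ | ⟨t, u⟩
    · rw [List.nil_append] at h
      exact h ▸ (bars_blockString_eq_closes _).le
    · rw [blockString_cons, List.cons_append, List.cons.injEq] at h
      rcases List.append_eq_append_iff.mp h.2 with ⟨a, rfl, h'⟩ | ⟨a, h', rfl⟩
      · exact ih h'
      · have htail := bars_le_closes_of_blockTail_eq h'
        have hrest := bars_blockString_eq_closes L
        simp only [bars_append, closes_append]
        omega

theorem exists_split_of_core (h : blockString L = u ++ Token.core q :: w) :
    ∃ L₁ k L₂, L = L₁ ++ (q, k) :: L₂ ∧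
      u = blockString L₁ ∧ w = blockTail q k ++ blockString L₂ := by
  induction L generalizing u with
  | nil => simp at h
  | cons p L ih =>
    obtain ⟨z, k⟩ := p
    rw [blockString_cons] at h
    rcases u with _ | ⟨t, u⟩
    · simp only [List.nil_append, List.cons.injEq, Token.sym.injEq, Sym.core.injEq] at h
      obtain ⟨rfl, rfl⟩ := h
      exact ⟨[], k, L, rfl, rfl, rfl⟩
    · rw [List.cons_append, List.cons.injEq] at h
      obtain ⟨rfl, h⟩ := h
      rcases List.append_eq_append_iff.mp h with ⟨a, rfl, h'⟩ | ⟨a, h', h''⟩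
      · obtain ⟨L₁, k', L₂, rfl, rfl, rfl⟩ := ih h'
        exact ⟨(z, k) :: L₁, k', L₂, rfl, (blockString_cons _ _ _).symm, rfl⟩
      · rcases a with _ | ⟨t, a⟩
        · obtain ⟨L₁, k', L₂, rfl, h1, rfl⟩ := ih (u := []) h''.symm
          refine ⟨(z, k) :: L₁, k', L₂, rfl, ?_, rfl⟩
          simp [blockString_cons, ← h1, h']
        · obtain ⟨rfl, -⟩ := List.cons.inj h''
          exact absurd (by simp [h']) (coreless_blockTail z k q)

theorem exists_last {P : Token → Prop} (h : ∃ t ∈ u, P t) :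
    ∃ u₁ t u₂, u = u₁ ++ t :: u₂ ∧ P t ∧ ∀ s ∈ u₂, ¬P s := by
  induction u with
  | nil => simp at h
  | cons t u ih =>
    by_cases hu : ∃ s ∈ u, P s
    · obtain ⟨u₁, s, u₂, rfl, hs⟩ := ih hu
      exact ⟨t :: u₁, s, u₂, rfl, hs⟩
    · have ht : P t := by simpa [hu] using h
      push Not at hu
      exact ⟨[], t, u, rfl, ht, hu⟩

theorem exists_last_eq {a : Token} (h : a ∈ u) : ∃ u₁ u₂, u = u₁ ++ a :: u₂ ∧ a ∉ u₂ := by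
  obtain ⟨u₁, _, u₂, rfl, rfl, h₂⟩ := exists_last (P := (· = a)) ⟨a, h, rfl⟩
  exact ⟨u₁, u₂, rfl, fun ha => h₂ _ ha rfl⟩

theorem exists_last_core (h : ¬Coreless u) :
    ∃ u₁ q u₂, u = u₁ ++ Token.core q :: u₂ ∧ Coreless u₂ := by
  simp only [Coreless, not_forall, not_not] at h
  obtain ⟨z, hz⟩ := h
  obtain ⟨u₁, _, u₂, rfl, ⟨q, rfl⟩, h₂⟩ :=
    exists_last (P := fun t => ∃ q, t = Token.core q) ⟨_, hz, z, rfl⟩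
  exact ⟨u₁, q, u₂, rfl, fun z hz => h₂ _ hz ⟨z, rfl⟩⟩

theorem exists_prefix_blockTail (h : blockString L = u ++ Token.core q :: (v ++ w))
    (hv : Coreless v) : ∃ L₁ k L₂, L = L₁ ++ (q, k) :: L₂ ∧ u = blockString L₁ ∧
      v <+: blockTail q k := by
  obtain ⟨L₁, k, L₂, hL, h1, h2⟩ := exists_split_of_core h
  refine ⟨L₁, k, L₂, hL, h1, ?_⟩
  rcases List.append_eq_append_iff.mp h2 with ⟨a, ha, -⟩ | ⟨a, rfl, ha⟩
  · exact ⟨a, ha.symm⟩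
  · rcases L₂ with _ | ⟨⟨z, k'⟩, L₂⟩
    · obtain ⟨rfl, -⟩ := List.append_eq_nil_iff.mp ha.symm
      simp
    · rcases a with _ | ⟨t, a⟩
      · simp
      · obtain ⟨rfl, -⟩ := List.cons.inj (ha.symm.trans (blockString_cons _ _ _))
        exact absurd (by simp) (hv z)

theorem coreless_append_iff : Coreless (u ++ v) ↔ Coreless u ∧ Coreless v := by
  simp only [Coreless, List.mem_append, not_or, forall_and]

theorem coreless_bar_cons : Coreless (Token.bar z :: v) ↔ Coreless v := by
  simp [Coreless]

theorem eq_of_bar_after_core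
    (h : blockString L = u ++ Token.core q :: (v ++ Token.bar z :: w)) (hv : Coreless v) :
    z = q := by
  have h' : blockString L = u ++ Token.core q :: ((v ++ [Token.bar z]) ++ w) := by simp [h]
  obtain ⟨_, k, _, -, -, hp⟩ := exists_prefix_blockTail h'
    (coreless_append_iff.mpr ⟨hv, by simp [Coreless]⟩)
  exact eq_of_bar_mem_blockTail (hp.subset (by simp))

theorem not_coreless_of_bar (h : blockString L = u ++ Token.bar z :: w) : ¬Coreless u := by
  intro hu
  rcases L with _ | ⟨⟨q, k⟩, L⟩
  · simp at h
  · rw [blockString_cons] at h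
    rcases u with _ | ⟨t, u⟩
    · simp at h
    · exact hu q (by simp [(List.cons.inj h).1])

theorem exists_core_of_bar (h : blockString L = u ++ Token.bar z :: w) :
    ∃ u₁ u₂, u = u₁ ++ Token.core z :: u₂ ∧ Coreless u₂ := by
  obtain ⟨u₁, q, u₂, rfl, hu₂⟩ := exists_last_core (not_coreless_of_bar h)
  rw [List.append_assoc, List.cons_append] at h
  obtain rfl := eq_of_bar_after_core h hu₂
  exact ⟨u₁, u₂, rfl, hu₂⟩

theorem bar_not_mem_of_prefix (h : blockString L = u ++ w) (hz : Token.core z ∉ u) :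
    Token.bar z ∉ u := by
  intro hb
  obtain ⟨a, b, rfl⟩ := List.append_of_mem hb
  rw [List.append_assoc, List.cons_append] at h
  obtain ⟨u₁, u₂, rfl, -⟩ := exists_core_of_bar h
  simp at hz

theorem bars_le_opens_after_core (h : blockString L = u ++ Token.core q :: (v ++ w)) :
    bars v ≤ opens v := by
  obtain ⟨L₁, k, L₂, -, -, h2⟩ := exists_split_of_core h
  have : blockString ((q, k) :: L₂) = (Token.core q :: v) ++ w := by
    rw [blockString_cons, ← h2, List.cons_append]
  simpa using bars_le_opens_of_prefix this

theorem bars_le_closes_before_core (h : blockString L = u ++ v ++ Token.core q :: w) :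
    bars v ≤ closes v := by
  obtain ⟨L₁, k, L₂, -, h1, -⟩ := exists_split_of_core h
  exact bars_le_closes_of_suffix h1.symm

theorem bars_eq_closes_after_core (h : blockString L = u ++ Token.core q :: w) :
    bars w = closes w := by
  obtain ⟨L₁, k, L₂, -, -, rfl⟩ := exists_split_of_core h
  simp [bars_blockString_eq_closes L₂]

theorem bar_not_mem_after_core (h : blockString L = u ++ Token.core q :: w)
    (hw : Token.core z ∉ w) (hq : q ≠ z) : Token.bar z ∉ w := by
  obtain ⟨L₁, k, L₂, -, -, rfl⟩ := exists_split_of_core h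
  rw [List.mem_append, not_or] at hw ⊢
  exact ⟨fun hb => hq (eq_of_bar_mem_blockTail hb).symm,
    bar_not_mem_of_prefix (List.append_nil _).symm hw.2⟩

theorem closes_le_of_core_mem (h : blockString L = u ++ v ++ w) (hq : Token.core q ∈ v) :
    closes w ≤ bars w + bars v := by
  obtain ⟨a, b, rfl⟩ := List.append_of_mem hq
  have h' : blockString L = (u ++ a) ++ Token.core q :: (b ++ w) := by simp [h]
  have := bars_eq_closes_after_core h'
  simp only [bars_append, closes_append, bars_core_cons] at this ⊢
  omega

theorem bars_eq_count_of_coreless (h : blockString L = u ++ Token.core q :: (v ++ w))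
    (hv : Coreless v) : bars v = v.count (Token.bar q) := by
  obtain ⟨_, k, _, -, -, hp⟩ := exists_prefix_blockTail h hv
  refine le_antisymm (List.countP_mono_left fun t ht h => ?_) (count_bar_le_bars q v)
  rcases t with (z | z) | _ | _
  · cases h
  · simp [eq_of_bar_mem_blockTail (hp.subset ht)]
  · cases h
  · cases h

theorem closes_le_of_coreless (h : blockString L = u ++ Token.core q :: (v ++ w))
    (hv : Coreless v) : closes w ≤ bars w + v.count (Token.bar q) := by
  have hbal := bars_eq_closes_after_core h
  have hbars := bars_eq_count_of_coreless h hv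
  simp only [bars_append, closes_append] at hbal
  omega

theorem coreless_before_bar (h : blockString L = u ++ m ++ Token.bar z :: w)
    (hm : Token.core z ∉ m) : Coreless m := by
  by_contra hc
  obtain ⟨m₁, q, m₂, rfl, hm₂⟩ := exists_last_core hc
  have h' : blockString L = (u ++ m₁) ++ Token.core q :: (m₂ ++ Token.bar z :: w) := by simp [h]
  obtain rfl := eq_of_bar_after_core h' hm₂
  simp at hm

theorem closes_eq_zero_of_bar
    (h : blockString L = u ++ Token.core q :: (m ++ Token.bar z :: w)) (hm : Token.core z ∉ m) :
    closes m = 0 := by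
  have hm' : blockString L = (u ++ [Token.core q]) ++ m ++ Token.bar z :: w := by simp [h]
  have hc := coreless_before_bar hm' hm
  have h' : blockString L = u ++ Token.core q :: ((m ++ [Token.bar z]) ++ w) := by simp [h]
  obtain ⟨_, k, _, -, -, hp⟩ := exists_prefix_blockTail h'
    (coreless_append_iff.mpr ⟨hc, by simp [Coreless]⟩)
  have hrank := List.pairwise_append.mp ((pairwise_rank_le_blockTail q k).sublist hp.sublist)
  exact List.count_eq_zero.mpr fun hr => by
    simpa [Token.rank] using hrank.2.2 _ hr (Token.bar z) (by simp)

theorem brackets_not_mem_between_bars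
    (h : blockString L = u ++ Token.bar z :: m ++ Token.bar z :: w) (hm : Token.core z ∉ m) :
    Token.lbr ∉ m ∧ Token.rbr ∉ m := by
  have hm' : blockString L = (u ++ [Token.bar z]) ++ m ++ Token.bar z :: w := by simp [h]
  have hc := coreless_before_bar hm' hm
  rw [List.append_assoc, List.cons_append] at h
  obtain ⟨u₁, u₂, rfl, hu₂⟩ := exists_core_of_bar h
  have h' : blockString L = u₁ ++ Token.core z ::
      ((u₂ ++ (Token.bar z :: (m ++ [Token.bar z]))) ++ w) := by simp [h]
  obtain ⟨_, k, _, -, -, hp⟩ := exists_prefix_blockTail h' (by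
    simp only [coreless_append_iff, coreless_bar_cons]
    exact ⟨hu₂, hc, by simp [Coreless]⟩)
  have hrank := (pairwise_rank_le_blockTail z k).sublist hp.sublist
  rw [List.pairwise_append, List.pairwise_cons, List.pairwise_append] at hrank
  obtain ⟨-, ⟨hfirst, -, -, hlast⟩, -⟩ := hrank
  exact ⟨fun hl => by simpa [Token.rank] using hfirst Token.lbr (by simp [hl]),
    fun hr => by simpa [Token.rank] using hlast Token.rbr hr (Token.bar z) (by simp)⟩

theorem brackets_not_mem_of_square (h : blockString L = u ++ (v ++ v) ++ w)
    (hb : Token.bar z ∈ v) (hc : Token.core z ∉ v) : Token.lbr ∉ v ∧ Token.rbr ∉ v := by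
  obtain ⟨a, b, rfl⟩ := List.append_of_mem hb
  have h' : blockString L = (u ++ a) ++ Token.bar z :: (b ++ a) ++ Token.bar z :: (b ++ w) := by
    simp [h]
  simp only [List.mem_append, List.mem_cons, not_or] at hc
  have := brackets_not_mem_between_bars h' (by simp [hc])
  simp only [List.mem_append, not_or] at this
  simp [this]

theorem core_mem_of_square (h : blockString L = u ++ (v ++ v) ++ w)
    (hle : bars v ≤ opens v ∨ bars v ≤ closes v) (hb : Token.bar z ∈ v) : Token.core z ∈ v := by
  by_contra hc
  obtain ⟨hl, hr⟩ := brackets_not_mem_of_square h hb hc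
  have hopens : opens v = 0 := List.count_eq_zero.mpr hl
  have hcloses : closes v = 0 := List.count_eq_zero.mpr hr
  have hpos := (List.count_pos_iff.mpr hb).trans_le (count_bar_le_bars z v)
  omega

end Strings

/-! ## Runs of a barred letter -/

section Runs

variable {L : List (Letter × ℕ)} {u v w : List Token} {z : Letter}

theorem bddAbove_runs (z : Token) (s : List Token) :
    BddAbove {n : ℕ | List.replicate n z <:+: s} :=
  ⟨s.length, fun n hn => by simpa using hn.length_le⟩

theorem le_maxRun {z : Token} {s : List Token} {n : ℕ} (h : List.replicate n z <:+: s) :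
    n ≤ maxRun z s :=
  le_csSup (bddAbove_runs z s) h

theorem replicate_maxRun (z : Token) (s : List Token) :
    List.replicate (maxRun z s) z <:+: s :=
  Nat.sSup_mem ⟨0, by simp⟩ (bddAbove_runs z s)

theorem le_maxRun_blockString (L₁ L₂ : List (Letter × ℕ)) (q : Letter) (k : ℕ) :
    k ≤ maxRun (Token.bar q) (blockString (L₁ ++ (q, k) :: L₂)) := by
  refine le_maxRun ⟨blockString L₁ ++ Token.core q :: List.replicate k .lbr,
    List.replicate k .rbr ++ blockString L₂, ?_⟩
  simp [blockString_append, blockString_cons, blockTail]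

theorem count_bar_le_maxRun_of_core
    (h : blockString L = u ++ Token.core z :: (v ++ w)) (hv : Token.core z ∉ v) :
    v.count (Token.bar z) ≤ maxRun (Token.bar z) (blockString L) := by
  obtain ⟨L₁, k, L₂, rfl, -, hsplit⟩ := exists_split_of_core h
  refine le_trans ?_ (le_maxRun_blockString L₁ L₂ z k)
  rw [← count_bar_blockTail z k]
  rcases List.append_eq_append_iff.mp hsplit with ⟨a, ha, -⟩ | ⟨a, rfl, ha⟩
  · simp [ha]
  · have hbar : Token.bar z ∉ a :=
      bar_not_mem_of_prefix ha fun hm => hv (List.mem_append_right _ hm)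
    simp [List.count_eq_zero.mpr hbar]

theorem count_bar_le_maxRun (h : blockString L = u ++ v ++ w) (hv : Token.core z ∉ v) :
    v.count (Token.bar z) ≤ maxRun (Token.bar z) (blockString L) := by
  by_cases hu : Token.core z ∈ u
  · obtain ⟨u₁, u₂, rfl, hu₂⟩ := exists_last_eq hu
    have h' : blockString L = u₁ ++ Token.core z :: ((u₂ ++ v) ++ w) := by simp [h]
    refine le_trans ?_ (count_bar_le_maxRun_of_core h' (by simp [hu₂, hv]))
    simp
  · have hbar := bar_not_mem_of_prefix (z := z) h (by simp [hu, hv])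
    rw [List.count_eq_zero.mpr fun hm => hbar (List.mem_append_right _ hm)]
    exact Nat.zero_le _

theorem count_bar_le_mul_maxRun (h : blockString L = u ++ v ++ w) :
    v.count (Token.bar z) ≤
      (v.count (Token.core z) + 1) * maxRun (Token.bar z) (blockString L) := by
  induction hn : v.count (Token.core z) generalizing v w with
  | zero => simpa using count_bar_le_maxRun h (List.count_eq_zero.mp hn)
  | succ n ih =>
    obtain ⟨v₁, v₂, rfl, hv₂⟩ :=
      exists_last_eq (List.count_pos_iff.mp (by omega : 0 < v.count (Token.core z)))
    have hn₁ : v₁.count (Token.core z) = n := by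
      simpa [List.count_eq_zero.mpr hv₂] using hn
    have h₁ : blockString L = u ++ v₁ ++ (Token.core z :: v₂ ++ w) := by simp [h]
    have h₂ : blockString L = (u ++ v₁) ++ Token.core z :: (v₂ ++ w) := by simp [h]
    calc (v₁ ++ Token.core z :: v₂).count (Token.bar z)
        = v₁.count (Token.bar z) + v₂.count (Token.bar z) := by simp
      _ ≤ (n + 1) * maxRun (Token.bar z) (blockString L) +
            maxRun (Token.bar z) (blockString L) :=
          Nat.add_le_add (ih h₁ hn₁) (count_bar_le_maxRun_of_core h₂ hv₂)
      _ = (n + 1 + 1) * maxRun (Token.bar z) (blockString L) := by ring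

theorem opens_le_maxRun (h : blockString L = u ++ Token.bar z :: w) :
    opens u ≤ bars u + maxRun (Token.bar z) (blockString L) := by
  obtain ⟨u₁, u₂, rfl, hu₂⟩ := exists_core_of_bar h
  rw [List.append_assoc, List.cons_append] at h
  obtain ⟨L₁, k, L₂, rfl, rfl, hp⟩ := exists_prefix_blockTail h hu₂
  have hrun := le_maxRun_blockString L₁ L₂ z k
  have hopens : opens u₂ ≤ k := opens_blockTail z k ▸ hp.sublist.count_le _
  have hbal := bars_blockString_eq_opens L₁
  simp only [opens_append, bars_append, opens_core_cons, bars_core_cons]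
  omega

theorem exists_maxRun_add_bars_le_opens (h : 0 < maxRun (Token.bar z) (blockString L)) :
    ∃ u w, blockString L = u ++ Token.bar z :: w ∧
      maxRun (Token.bar z) (blockString L) + bars u ≤ opens u := by
  obtain ⟨a, b, hab⟩ := replicate_maxRun (Token.bar z) (blockString L)
  generalize maxRun (Token.bar z) (blockString L) = n at h hab ⊢
  obtain ⟨n, rfl⟩ := Nat.exists_eq_add_one.mpr h
  obtain ⟨u₁, u₂, rfl, hu₂⟩ := exists_core_of_bar (u := a) (z := z)
    (w := List.replicate n (Token.bar z) ++ b) (by rw [← hab, List.replicate_succ]; simp)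
  obtain ⟨L₁, k, L₂, rfl, rfl, hp⟩ := exists_prefix_blockTail (L := L) (u := u₁) (q := z)
    (v := u₂ ++ List.replicate (n + 1) (Token.bar z)) (w := b) (by simp [← hab])
    (coreless_append_iff.mpr ⟨hu₂, by simp [Coreless, List.mem_replicate]⟩)
  have hn : n + 1 ≤ k := by
    have := hp.sublist.count_le (Token.bar z)
    rw [count_bar_blockTail, List.count_append, List.count_replicate_self] at this
    omega
  obtain ⟨m, rfl⟩ := Nat.exists_eq_add_one.mpr (h.trans_le hn)
  refine ⟨blockString L₁ ++ Token.core z :: List.replicate (m + 1) .lbr,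
    List.replicate m (Token.bar z) ++ (List.replicate (m + 1) .rbr ++ blockString L₂), ?_, ?_⟩
  · rw [blockString_append, blockString_cons, blockTail, List.replicate_succ (a := Token.bar z)]
    simp
  · have hopens : opens (List.replicate (m + 1) Token.lbr) = m + 1 := by simp [opens]
    have hbars : bars (List.replicate (m + 1) Token.lbr) = 0 := by
      simp [bars, List.countP_replicate, Token.isBar]
    have hbal := bars_blockString_eq_opens L₁
    simp only [opens_append, bars_append, opens_core_cons, bars_core_cons]
    omega

end Runs

/-! ## Pumped strings -/

section Pumped

variable {L : List (Letter × ℕ)} {u v w : List Token} {z q : Letter}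

/-- The `i`-th power of a string. -/
def power (i : ℕ) (v : List Token) : List Token := (List.replicate i v).flatten

@[simp] theorem power_zero (v : List Token) : power 0 v = [] := rfl

theorem power_succ (i : ℕ) (v : List Token) : power (i + 1) v = v ++ power i v := by
  simp [power, List.replicate_succ]

theorem power_succ' (i : ℕ) (v : List Token) : power (i + 1) v = power i v ++ v := by
  simp [power, List.replicate_succ']

@[simp] theorem power_two (v : List Token) : power 2 v = v ++ v := by
  simp [power_succ]

theorem countP_power (P : Token → Bool) (i : ℕ) (v : List Token) :
    (power i v).countP P = i * v.countP P := by
  simp [power, List.countP_flatten, List.map_replicate]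

@[simp] theorem bars_power (i : ℕ) (v : List Token) : bars (power i v) = i * bars v :=
  countP_power _ i v

@[simp] theorem opens_power (i : ℕ) (v : List Token) : opens (power i v) = i * opens v :=
  countP_power _ i v

@[simp] theorem closes_power (i : ℕ) (v : List Token) : closes (power i v) = i * closes v :=
  countP_power _ i v

theorem le_of_forall_add_mul_le {a b c d : ℕ} (h : ∀ i, a + i * b ≤ c + i * d) : b ≤ d := by
  have := h (c + 1)
  by_contra! hlt
  nlinarith

theorem core_mem_of_pump_before_core
    (h : ∀ i, ∃ L u w', blockString L = u ++ (power i v ++ w) ++ Token.core q :: w')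
    (hb : Token.bar z ∈ v) : Token.core z ∈ v := by
  obtain ⟨L, u, w', h2⟩ := h 2
  have h' : blockString L = u ++ (v ++ v) ++ (w ++ Token.core q :: w') := by simp [h2]
  refine core_mem_of_square h' (.inr ?_) hb
  refine le_of_forall_add_mul_le (a := bars w) (c := closes w) fun i => ?_
  obtain ⟨_, _, _, hi⟩ := h i
  simpa [add_comm] using bars_le_closes_before_core hi

theorem core_mem_of_pump_after_core
    (h : ∀ i, ∃ L u' w, blockString L = u' ++ Token.core q :: ((u ++ power i v) ++ w))
    (hb : Token.bar z ∈ v) : Token.core z ∈ v := by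
  obtain ⟨L, u', w, h2⟩ := h 2
  have h' : blockString L = (u' ++ Token.core q :: u) ++ (v ++ v) ++ w := by simp [h2]
  refine core_mem_of_square h' (.inl ?_) hb
  refine le_of_forall_add_mul_le (a := bars u) (c := opens u) fun i => ?_
  obtain ⟨_, _, _, hi⟩ := h i
  simpa using bars_le_opens_after_core hi

/-- `pumped [(a₁, v₁), …, (aₙ, vₙ)] e i` is `a₁ v₁ⁱ … aₙ vₙⁱ e`. -/
def pumped : List (List Token × List Token) → List Token → ℕ → List Token
  | [], e, _ => e
  | (a, v) :: Q, e, i => a ++ (power i v ++ pumped Q e i)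

theorem exists_pumped_eq_append_cons {c : Token} (Q : List (List Token × List Token))
    {e u w : List Token} (h : pumped Q e 0 = u ++ c :: w) : ∃ f g : ℕ → List Token,
      (∀ i, pumped Q e i = f i ++ c :: g i) ∧
        ∀ P, ∃ d, ∀ i, (f i).countP P = u.countP P + i * d := by
  induction Q generalizing u with
  | nil => exact ⟨fun _ => u, fun _ => w, fun _ => h, fun _ => ⟨0, by simp⟩⟩
  | cons p Q ih =>
    obtain ⟨a, v⟩ := p
    rw [pumped, power_zero, List.nil_append] at h
    have hsplit : (∃ b, u = a ++ b ∧ pumped Q e 0 = b ++ c :: w) ∨ ∃ b, a = u ++ c :: b := by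
      rcases List.append_eq_append_iff.mp h with ⟨b, rfl, h'⟩ | ⟨_ | ⟨t, b⟩, rfl, h'⟩
      · exact .inl ⟨b, rfl, h'⟩
      · exact .inl ⟨[], by simp, h'.symm⟩
      · exact .inr ⟨b, by rw [(List.cons.inj h').1]⟩
    rcases hsplit with ⟨b, rfl, h'⟩ | ⟨b, rfl⟩
    · obtain ⟨f, g, hfg, hP⟩ := ih h'
      refine ⟨fun i => a ++ power i v ++ f i, g, fun i => by simp [pumped, hfg], fun P => ?_⟩
      obtain ⟨d, hd⟩ := hP P
      exact ⟨v.countP P + d, fun i => by simp only [List.countP_append, countP_power, hd]; ring⟩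
    · exact ⟨fun _ => u, fun i => b ++ (power i v ++ pumped Q e i), fun i => by simp [pumped],
        fun P => ⟨0, by simp⟩⟩

/-- A longest run lies in a block whose opening brackets, and with them the run, can only
become more numerous. -/
theorem maxRun_pumped_le {Q : List (List Token × List Token)} {e : List Token}
    (h : ∀ i, ∃ L, blockString L = pumped Q e i) (z : Letter) :
    maxRun (Token.bar z) (pumped Q e 0) ≤ maxRun (Token.bar z) (pumped Q e 1) := by
  rcases Nat.eq_zero_or_pos (maxRun (Token.bar z) (pumped Q e 0)) with h0 | hpos
  · rw [h0]
    exact Nat.zero_le _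
  obtain ⟨L₀, hL₀⟩ := h 0
  rw [← hL₀] at hpos
  obtain ⟨u, w, huw, hle⟩ := exists_maxRun_add_bars_le_opens hpos
  rw [hL₀] at huw hle
  obtain ⟨f, g, hfg, hP⟩ := exists_pumped_eq_append_cons Q huw
  obtain ⟨d, hbars : ∀ i, bars (f i) = bars u + i * d⟩ := hP Token.isBar
  obtain ⟨d', hopens : ∀ i, opens (f i) = opens u + i * d'⟩ := hP (· == Token.lbr)
  have hd : d ≤ d' := le_of_forall_add_mul_le (a := bars u) (c := opens u) fun i => by
    obtain ⟨L, hi⟩ := h i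
    rw [← hbars, ← hopens]
    exact bars_le_opens_of_prefix (hi.trans (hfg i))
  obtain ⟨L₁, hL₁⟩ := h 1
  have hrun := opens_le_maxRun (hL₁.trans (hfg 1))
  rw [hL₁, hbars, hopens] at hrun
  omega

/-- All the strings `l₁ l₂ⁱ l₃ l₄ⁱ w r₄ⁱ r₃ r₂ⁱ r₁` are concatenations of blocks. The names match
the contexts `C₁, …, C₄` of a pumping decomposition, with `lⱼ` and `rⱼ` on the two sides of the
hole of `Cⱼ`. -/
def PumpsBlocks (l₁ l₂ l₃ l₄ w r₄ r₃ r₂ r₁ : List Token) : Prop :=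
  ∀ i, ∃ L, blockString L = pumped [(l₁, l₂), (l₃, l₄), (w, r₄), (r₃, r₂)] r₁ i

namespace PumpsBlocks

variable {l₁ l₂ l₃ l₄ w r₄ r₃ r₂ r₁ : List Token}

theorem core_mem_outer_left (hs : PumpsBlocks l₁ l₂ l₃ l₄ w r₄ r₃ r₂ r₁)
    (hb : Token.bar z ∈ l₂) : Token.core z ∈ l₂ := by
  obtain ⟨L, h2⟩ := hs 2
  have h' : blockString L = l₁ ++ (l₂ ++ l₂) ++ pumped [(l₃, l₄), (w, r₄), (r₃, r₂)] r₁ 2 := by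
    simp [h2, pumped]
  refine core_mem_of_square h' (.inl ?_) hb
  refine le_of_forall_add_mul_le (a := bars l₁) (c := opens l₁) fun i => ?_
  obtain ⟨L, hi⟩ := hs i
  have hi' : blockString L =
      l₁ ++ power i l₂ ++ pumped [(l₃, l₄), (w, r₄), (r₃, r₂)] r₁ i := by simp [hi, pumped]
  simpa using bars_le_opens_of_prefix hi'

theorem bars_outer_right_le (hs : PumpsBlocks l₁ l₂ l₃ l₄ w r₄ r₃ r₂ r₁) :
    bars r₂ ≤ closes r₂ := by
  refine le_of_forall_add_mul_le (a := bars r₁) (c := closes r₁) fun i => ?_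
  obtain ⟨L, hi⟩ := hs i
  have hi' : blockString L = pumped [(l₁, l₂), (l₃, l₄), (w, r₄)] r₃ i ++ (power i r₂ ++ r₁) := by
    simp [hi, pumped]
  simpa [add_comm] using bars_le_closes_of_suffix hi'

theorem core_mem_outer_right (hs : PumpsBlocks l₁ l₂ l₃ l₄ w r₄ r₃ r₂ r₁)
    (hb : Token.bar z ∈ r₂) : Token.core z ∈ r₂ := by
  obtain ⟨L, h2⟩ := hs 2
  have h' : blockString L = pumped [(l₁, l₂), (l₃, l₄), (w, r₄)] r₃ 2 ++ (r₂ ++ r₂) ++ r₁ := by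
    simp [h2, pumped]
  exact core_mem_of_square h' (.inr hs.bars_outer_right_le) hb

theorem bars_right_le (hs : PumpsBlocks l₁ l₂ l₃ l₄ w r₄ r₃ r₂ r₁) :
    bars r₄ + bars r₂ ≤ closes r₄ + closes r₂ := by
  refine le_of_forall_add_mul_le (a := bars r₃ + bars r₁) (c := closes r₃ + closes r₁)
    fun i => ?_
  obtain ⟨L, hi⟩ := hs i
  have hi' : blockString L =
      pumped [(l₁, l₂), (l₃, l₄)] w i ++ (power i r₄ ++ (r₃ ++ (power i r₂ ++ r₁))) := by
    simp [hi, pumped]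
  have := bars_le_closes_of_suffix hi'
  simp only [bars_append, closes_append, bars_power, closes_power] at this
  linarith

theorem core_mem_inner_left (hs : PumpsBlocks l₁ l₂ l₃ l₄ w r₄ r₃ r₂ r₁)
    (hq : Token.core q ∈ l₃ ++ w) (hb : Token.bar z ∈ l₄) : Token.core z ∈ l₄ := by
  rcases List.mem_append.mp hq with hq | hq <;> obtain ⟨a, b, rfl⟩ := List.append_of_mem hq
  · refine core_mem_of_pump_after_core (u := b) (q := q) (fun i => ?_) hb
    obtain ⟨L, hL⟩ := hs i
    exact ⟨L, l₁ ++ power i l₂ ++ a, pumped [(w, r₄), (r₃, r₂)] r₁ i, by simp [hL, pumped]⟩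
  · refine core_mem_of_pump_before_core (w := a) (q := q) (fun i => ?_) hb
    obtain ⟨L, hL⟩ := hs i
    exact ⟨L, l₁ ++ power i l₂ ++ l₃, pumped [(b, r₄), (r₃, r₂)] r₁ i, by simp [hL, pumped]⟩

theorem core_mem_inner_right (hs : PumpsBlocks l₁ l₂ l₃ l₄ w r₄ r₃ r₂ r₁)
    (hq : Token.core q ∈ w ++ r₃) (hb : Token.bar z ∈ r₄) : Token.core z ∈ r₄ := by
  rcases List.mem_append.mp hq with hq | hq <;> obtain ⟨a, b, rfl⟩ := List.append_of_mem hq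
  · refine core_mem_of_pump_after_core (u := b) (q := q) (fun i => ?_) hb
    obtain ⟨L, hL⟩ := hs i
    exact ⟨L, pumped [(l₁, l₂), (l₃, l₄)] a i, r₃ ++ (power i r₂ ++ r₁), by simp [hL, pumped]⟩
  · refine core_mem_of_pump_before_core (w := a) (q := q) (fun i => ?_) hb
    obtain ⟨L, hL⟩ := hs i
    exact ⟨L, pumped [(l₁, l₂), (l₃, l₄)] w i, b ++ (power i r₂ ++ r₁), by simp [hL, pumped]⟩

theorem bars_eq_opens (hs : PumpsBlocks l₁ l₂ l₃ l₄ w r₄ r₃ r₂ r₁) :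
    bars l₂ + bars l₄ + bars r₄ + bars r₂ = opens l₂ + opens l₄ + opens r₄ + opens r₂ := by
  obtain ⟨L, hL⟩ := hs 0
  obtain ⟨L', hL'⟩ := hs 1
  have h := bars_blockString_eq_opens L
  have h' := bars_blockString_eq_opens L'
  simp only [hL, hL', pumped, bars_append, opens_append, bars_power, opens_power] at h h'
  omega

theorem bars_eq_closes (hs : PumpsBlocks l₁ l₂ l₃ l₄ w r₄ r₃ r₂ r₁) :
    bars l₂ + bars l₄ + bars r₄ + bars r₂ = closes l₂ + closes l₄ + closes r₄ + closes r₂ := by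
  obtain ⟨L, hL⟩ := hs 0
  obtain ⟨L', hL'⟩ := hs 1
  have h := bars_blockString_eq_closes L
  have h' := bars_blockString_eq_closes L'
  simp only [hL, hL', pumped, bars_append, closes_append, bars_power, closes_power] at h h'
  omega

end PumpsBlocks

end Pumped

/-! ## The strings of `CSDs` -/

section CSDs

theorem blocks_eq_blockString (z : Letter) (l : List ℕ) :
    blocks z l = blockString (l.map fun k => (z, k)) := by
  simp [blocks, blockString, List.flatMap_map]

theorem exists_blockString {s : List Token} (h : s ∈ CSDs) : ∃ L, blockString L = s := by
  obtain ⟨ka, kb, kc, kd, -, -, -, -, rfl⟩ := h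
  simp only [blocks_eq_blockString, ← blockString_append]
  exact ⟨_, rfl⟩

theorem count_core_blocks (z q : Letter) (l : List ℕ) :
    (blocks z l).count (Token.core q) = if z = q then l.length else 0 := by
  have hblock (k : ℕ) : (block z k).count (Token.core q) = if z = q then 1 else 0 := by
    by_cases h : z = q <;> simp [h, block, List.count_replicate]
  simp [blocks, List.count_flatMap, Function.comp_def, hblock]

theorem count_core_of_mem {s : List Token} (h : s ∈ CSDs) {x y : Letter} (hxy : Sep x y) :
    s.count (Token.core x) = s.count (Token.core y) ∧ 0 < s.count (Token.core x) := by
  obtain ⟨ka, kb, kc, kd, ha, hb, hc, hd, rfl⟩ := h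
  cases hxy <;>
    simp only [List.count_append, count_core_blocks, reduceCtorEq, if_true, if_false] <;> omega

end CSDs

/-! ## Surplus of tokens over edges -/

section Surplus

variable {Δ : Signature} {c : Sym → Δ.Op → ℕ} {z : Letter}

/-- The number of `z̄`-tokens minus the number of `z̄`-edges generated by a tree, where `c s f` is
the number of `s`-edges contributed by the symbol `f`. -/
def Tree.surplus (c : Sym → Δ.Op → ℕ) (z : Letter) (t : Tree Δ) : ℤ :=
  t.yield.count (Token.bar z) - t.weight (c (.bar z))

/-- The number of `z̄`-tokens minus the number of `z̄`-edges generated by a context. -/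
def Ctx.surplus (c : Sym → Δ.Op → ℕ) (z : Letter) (C : Ctx Δ) : ℤ :=
  C.yield.count (Token.bar z) - C.weight (c (.bar z))

namespace Ctx

theorem count_yield_plug (a : Token) (C : Ctx Δ) (t : Tree Δ) :
    (C.plug t).yield.count a = C.yield.count a + t.yield.count a := by
  simp only [yield_plug, yield, List.count_append]
  omega

theorem count_yield_comp (a : Token) (C D : Ctx Δ) :
    (C.comp D).yield.count a = C.yield.count a + D.yield.count a := by
  simp only [yield, left_comp, right_comp, List.count_append]
  omega

theorem mem_yield_plug {a : Token} {C : Ctx Δ} {t : Tree Δ} :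
    a ∈ (C.plug t).yield ↔ a ∈ C.yield ∨ a ∈ t.yield := by
  simp only [yield_plug, yield, List.mem_append]
  tauto

theorem mem_yield_comp {a : Token} {C D : Ctx Δ} :
    a ∈ (C.comp D).yield ↔ a ∈ C.yield ∨ a ∈ D.yield := by
  simp only [yield, left_comp, right_comp, List.mem_append]
  tauto

theorem length_yield_comp (C D : Ctx Δ) :
    (C.comp D).yield.length = C.yield.length + D.yield.length := by
  simp only [yield, left_comp, right_comp, List.length_append]
  omega

theorem surplus_plug (C : Ctx Δ) (t : Tree Δ) :
    (C.plug t).surplus c z = C.surplus c z + t.surplus c z := by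
  simp only [Tree.surplus, surplus, count_yield_plug, weight_plug]
  push_cast
  ring

theorem surplus_comp (C D : Ctx Δ) :
    (C.comp D).surplus c z = C.surplus c z + D.surplus c z := by
  simp only [surplus, count_yield_comp, weight_comp]
  push_cast
  ring

theorem surplus_nonpos {C : Ctx Δ} (h : Token.bar z ∉ C.yield) : C.surplus c z ≤ 0 := by
  simp [surplus, List.count_eq_zero.mpr h]

end Ctx

end Surplus

/-! ## Bounds at a cut of a tree -/

section CutBounds

variable {Δ : Signature} {c : Sym → Δ.Op → ℕ} {x y : Letter} {l : ℕ}
variable {L : List (Letter × ℕ)} {E E' : Ctx Δ} {t t' : Tree Δ}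

/-- The number of unmatched closing brackets to the right of the hole. -/
def Ctx.depth (E : Ctx Δ) : ℕ := closes E.right - bars E.right

/-- The surpluses of the subtree `t` of `E[t]` are bounded from below for `x̄` and from above for
`ȳ`. The bound `le_run` is the one of interest. The other two bounds for `ȳ` make the induction
work: each pumping step that adds letters may worsen a bound by `l / 3`, which `le_depth` absorbs,
and `le_last` holds if `y` is the last unbarred letter of `t`, when `ȳ` can be split between `t`
and `E`. -/
structure CutBound (c : Sym → Δ.Op → ℕ) (x y : Letter) (l : ℕ) (E : Ctx Δ) (t : Tree Δ) :
    Prop where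
  neg_le : -((E.plug t).yield.count (Token.core x) * l : ℤ) ≤ t.surplus c x
  le_run : t.surplus c y ≤ (E.plug t).yield.count (Token.core x) * l +
    maxRun (Token.bar y) (E.plug t).yield
  le_depth : 3 * t.surplus c y ≤ 3 * ((E.plug t).yield.count (Token.core x) * l) +
    max (3 * E.depth : ℤ) l
  le_last : ∀ u v, t.yield = u ++ Token.core y :: v → Coreless v →
    t.surplus c y ≤ (E.plug t).yield.count (Token.core x) * l + v.count (Token.bar y)

theorem CutBound.of_le (hn : 0 < (E.plug t).yield.count (Token.core x))
    (hx : -(l : ℤ) ≤ t.surplus c x) (hy : t.surplus c y ≤ l) : CutBound c x y l E t := by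
  have hl : (l : ℤ) ≤ (E.plug t).yield.count (Token.core x) * l :=
    mod_cast Nat.le_mul_of_pos_left l hn
  exact ⟨by omega, by omega, by omega, fun _ _ _ _ => by omega⟩

theorem depth_le_of_last (hL : blockString L = (E.plug t).yield) {u v : List Token}
    (h : t.yield = u ++ Token.core y :: v) (hv : Coreless v) :
    E.depth ≤ v.count (Token.bar y) := by
  have h' : blockString L = (E.left ++ u) ++ Token.core y :: (v ++ E.right) := by
    simp [hL, Ctx.yield_plug, h]
  exact Nat.sub_le_iff_le_add'.mpr (closes_le_of_coreless h' hv)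

theorem CutBound.of_count_lt (hb : CutBound c x y l E' t')
    (hL : blockString L = (E.plug t).yield)
    (hlt : (E'.plug t').yield.count (Token.core x) < (E.plug t).yield.count (Token.core x))
    (hrun : maxRun (Token.bar y) (E'.plug t').yield ≤ maxRun (Token.bar y) (E.plug t).yield)
    (hσ : ∀ z, 3 * |t.surplus c z - t'.surplus c z| ≤ l)
    (hdepth : 3 * E'.depth ≤ max (3 * E.depth) l) : CutBound c x y l E t := by
  obtain ⟨hneg, hle_run, hle_depth, -⟩ := hb
  have hσx := abs_le.mp (Int.le_ediv_of_mul_le three_pos ((mul_comm _ _).trans_le (hσ x)))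
  have hσy := abs_le.mp (Int.le_ediv_of_mul_le three_pos ((mul_comm _ _).trans_le (hσ y)))
  have hmul : ((E'.plug t').yield.count (Token.core x) * l + l : ℤ) ≤
      (E.plug t).yield.count (Token.core x) * l := by
    exact_mod_cast (Nat.succ_mul _ l).symm.trans_le (Nat.mul_le_mul_right l hlt)
  refine ⟨by omega, by omega, by omega, fun u v huv hv => ?_⟩
  have := depth_le_of_last hL huv hv
  omega

theorem exists_last_of_sublist {α : Type*} [DecidableEq α] {a : α} {s s' u v : List α}
    (hsub : s'.Sublist s) (hcount : s'.count a = s.count a) (hs : s = u ++ a :: v) :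
    ∃ u' v', s' = u' ++ a :: v' ∧ v'.Sublist v := by
  subst hs
  obtain ⟨b, d, rfl, hb, hd⟩ := List.sublist_append_iff.mp hsub
  rcases List.sublist_cons_iff.mp hd with hd | ⟨e, rfl, he⟩
  · have hbu := hb.count_le a
    have hdv := hd.count_le a
    rw [List.count_append, List.count_append, List.count_cons_self] at hcount
    omega
  · exact ⟨b, e, rfl, he⟩

theorem CutBound.of_count_eq (hb : CutBound c x y l E' t')
    (hx : (E'.plug t').yield.count (Token.core x) = (E.plug t).yield.count (Token.core x))
    (hy : t'.yield.count (Token.core y) = t.yield.count (Token.core y))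
    (hsub : t'.yield.Sublist t.yield)
    (hrun : maxRun (Token.bar y) (E'.plug t').yield ≤ maxRun (Token.bar y) (E.plug t).yield)
    (hσx : t'.surplus c x ≤ t.surplus c x) (hσy : t.surplus c y ≤ t'.surplus c y)
    (hdepth : 3 * E'.depth ≤ max (3 * E.depth) l) : CutBound c x y l E t := by
  obtain ⟨hneg, hle_run, hle_depth, hle_last⟩ := hb
  rw [hx] at hneg hle_run hle_depth hle_last
  refine ⟨by omega, by omega, by omega, fun u v huv hv => ?_⟩
  obtain ⟨u', v', huv', hv'⟩ := exists_last_of_sublist hsub hy huv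
  have hlast := hle_last u' v' huv' fun z hz => hv z (hv'.subset hz)
  have hcount := hv'.count_le (Token.bar y)
  omega

theorem eq_of_append_core_cons_eq {u v u' v' : List Token}
    (h : u ++ Token.core y :: v = u' ++ Token.core y :: v') (hv : Token.core y ∉ v)
    (hv' : Token.core y ∉ v') : v = v' := by
  rcases List.append_eq_append_iff.mp h with ⟨_ | ⟨b, a⟩, rfl, h'⟩ | ⟨_ | ⟨b, a⟩, rfl, h'⟩
  · exact (List.cons.inj h').2
  · exact absurd (by simp [(List.cons.inj h').2]) hv
  · exact (List.cons.inj h').2.symm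
  · exact absurd (by simp [(List.cons.inj h').2]) hv'

/-- The `ȳ` after the last `y` of `t` form a single run, and there are at most `l` others. -/
theorem CutBound.of_tail (hL : blockString L = (E.plug t).yield)
    (hn : 0 < (E.plug t).yield.count (Token.core x))
    (hx : -((E.plug t).yield.count (Token.core x) * l : ℤ) ≤ t.surplus c x)
    {u m v : List Token} (ht : t.yield = u ++ Token.core y :: (m ++ Token.bar y :: v))
    (hm : Token.core y ∉ m) (hv : Token.core y ∉ v) (hlen : u.length + v.length ≤ l) :
    CutBound c x y l E t := by
  have hl : (l : ℤ) ≤ (E.plug t).yield.count (Token.core x) * l :=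
    mod_cast Nat.le_mul_of_pos_left l hn
  have hy : Token.core y ∉ m ++ Token.bar y :: v := by simp [hm, hv]
  have hu : u.count (Token.bar y) ≤ u.length := List.count_le_length
  have hσ : t.surplus c y ≤
      u.count (Token.bar y) + (m ++ Token.bar y :: v).count (Token.bar y) := by
    simp [Tree.surplus, ht]
  refine ⟨hx, ?_, ?_, fun u' v' huv hv' => ?_⟩
  · have h' : blockString L =
        (E.left ++ u ++ [Token.core y]) ++ (m ++ Token.bar y :: v) ++ E.right := by
      simp [hL, Ctx.yield_plug, ht]
    have hrun := count_bar_le_maxRun h' hy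
    rw [hL] at hrun
    omega
  · have h' : blockString L =
        (E.left ++ u) ++ Token.core y :: (m ++ Token.bar y :: (v ++ E.right)) := by
      simp [hL, Ctx.yield_plug, ht]
    have hm₀ := closes_eq_zero_of_bar h' hm
    have hbal := bars_eq_closes_after_core h'
    have hclose : closes v ≤ v.length := List.count_le_length
    have hbars := count_bar_le_bars y (m ++ Token.bar y :: v)
    have htail : m ++ Token.bar y :: (v ++ E.right) = (m ++ Token.bar y :: v) ++ E.right := by simp
    have hcons : closes (m ++ Token.bar y :: v) = closes m + closes v := by simp [closes]
    rw [htail, bars_append, closes_append, hcons, hm₀] at hbal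
    unfold Ctx.depth
    omega
  · obtain rfl := eq_of_append_core_cons_eq (huv.symm.trans ht) (hv' y) hy
    omega

end CutBounds

/-! ## Pumping steps -/

section Pumping

variable {Δ : Signature} {c : Sym → Δ.Op → ℕ} {x y z q : Letter} {l : ℕ}

/-- What the pumping argument uses of a language `T` that generates `CSD`: the yields are
concatenations of blocks with as many letters `x` as `y`, at least one, and the weights `c z̄` of a
tree add up to its number of `z̄`-tokens. -/
structure IsBalanced (c : Sym → Δ.Op → ℕ) (x y : Letter) (T : Set (Tree Δ)) : Prop where
  blocks : ∀ t ∈ T, ∃ L, blockString L = t.yield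
  weight_eq : ∀ t ∈ T, ∀ z, t.weight (c (.bar z)) = t.yield.count (Token.bar z)
  count_eq : ∀ t ∈ T, t.yield.count (Token.core x) = t.yield.count (Token.core y)
  pos : ∀ t ∈ T, 0 < t.yield.count (Token.core x)

theorem IsBalanced.surplus_eq_zero {T : Set (Tree Δ)} (hT : IsBalanced c x y T) {t : Tree Δ}
    (ht : t ∈ T) : t.surplus c z = 0 := by
  rw [Tree.surplus, hT.weight_eq t ht, sub_self]

theorem IsBalanced.core_mem {T : Set (Tree Δ)} (hT : IsBalanced c x y T) {t : Tree Δ}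
    (ht : t ∈ T) : Token.core y ∈ t.yield :=
  List.count_pos_iff.mp (hT.count_eq t ht ▸ hT.pos t ht)

/-- A decomposition whose pumped trees all belong to `T`, with a pumped part that generates at
most `l` tokens and at most `l` edges of each kind. -/
structure Pumps (c : Sym → Δ.Op → ℕ) (l : ℕ) (T : Set (Tree Δ)) (C₁ C₂ C₃ C₄ : Ctx Δ)
    (t₅ : Tree Δ) : Prop where
  mem : ∀ i, C₁.plug ((Ctx.pump C₂ C₃ C₄ i).plug t₅) ∈ T
  length_le : (C₂.comp (C₃.comp C₄)).yield.length ≤ l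
  weight_le : ∀ z, (C₂.comp (C₃.comp C₄)).weight (c z) ≤ l

theorem Ctx.left_pump (C₂ C₃ C₄ : Ctx Δ) (i : ℕ) :
    (Ctx.pump C₂ C₃ C₄ i).left = power i C₂.left ++ (C₃.left ++ power i C₄.left) := by
  induction i with
  | zero => simp [Ctx.pump]
  | succ i ih =>
    rw [Ctx.pump, Ctx.left_comp, Ctx.left_comp, ih, power_succ, power_succ']
    simp only [List.append_assoc]

theorem Ctx.right_pump (C₂ C₃ C₄ : Ctx Δ) (i : ℕ) :
    (Ctx.pump C₂ C₃ C₄ i).right = power i C₄.right ++ (C₃.right ++ power i C₂.right) := by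
  induction i with
  | zero => simp [Ctx.pump]
  | succ i ih =>
    rw [Ctx.pump, Ctx.right_comp, Ctx.right_comp, ih, power_succ, power_succ']
    simp only [List.append_assoc]

theorem yield_plug_pump (C₁ C₂ C₃ C₄ : Ctx Δ) (t₅ : Tree Δ) (i : ℕ) :
    (C₁.plug ((Ctx.pump C₂ C₃ C₄ i).plug t₅)).yield =
      pumped [(C₁.left, C₂.left), (C₃.left, C₄.left), (t₅.yield, C₄.right), (C₃.right, C₂.right)]
        C₁.right i := by
  simp [Ctx.yield_plug, Ctx.left_pump, Ctx.right_pump, pumped]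

theorem plug_pump_one (C₁ C₂ C₃ C₄ : Ctx Δ) (t₅ : Tree Δ) :
    C₁.plug ((Ctx.pump C₂ C₃ C₄ 1).plug t₅) = C₁.plug (C₂.plug (C₃.plug (C₄.plug t₅))) := by
  simp only [Ctx.pump, Ctx.plug_comp]

namespace Pumps

variable {T : Set (Tree Δ)} {C₁ C₂ C₃ C₄ : Ctx Δ} {t₅ : Tree Δ}

theorem mem_zero (h : Pumps c l T C₁ C₂ C₃ C₄ t₅) : C₁.plug (C₃.plug t₅) ∈ T := h.mem 0

theorem mem_one (h : Pumps c l T C₁ C₂ C₃ C₄ t₅) :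
    C₁.plug (C₂.plug (C₃.plug (C₄.plug t₅))) ∈ T :=
  plug_pump_one C₁ C₂ C₃ C₄ t₅ ▸ h.mem 1

theorem pumpsBlocks (hT : IsBalanced c x y T) (h : Pumps c l T C₁ C₂ C₃ C₄ t₅) :
    PumpsBlocks C₁.left C₂.left C₃.left C₄.left t₅.yield C₄.right C₃.right C₂.right C₁.right :=
  fun i => yield_plug_pump C₁ C₂ C₃ C₄ t₅ i ▸ hT.blocks _ (h.mem i)

theorem maxRun_le (hT : IsBalanced c x y T) (h : Pumps c l T C₁ C₂ C₃ C₄ t₅) (z : Letter) :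
    maxRun (Token.bar z) (C₁.plug (C₃.plug t₅)).yield ≤
      maxRun (Token.bar z) (C₁.plug (C₂.plug (C₃.plug (C₄.plug t₅)))).yield := by
  have hrun := maxRun_pumped_le (h.pumpsBlocks hT) z
  rwa [← yield_plug_pump, ← yield_plug_pump, plug_pump_one] at hrun

theorem surplus_comp_eq_zero (hT : IsBalanced c x y T) (h : Pumps c l T C₁ C₂ C₃ C₄ t₅) :
    (C₂.comp C₄).surplus c z = 0 := by
  have h₀ := hT.surplus_eq_zero h.mem_zero (z := z)
  have h₁ := hT.surplus_eq_zero h.mem_one (z := z)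
  simp only [Ctx.surplus_plug, Ctx.surplus_comp] at h₀ h₁ ⊢
  omega

theorem count_core_eq (hT : IsBalanced c x y T) (h : Pumps c l T C₁ C₂ C₃ C₄ t₅) :
    (C₂.comp C₄).yield.count (Token.core x) = (C₂.comp C₄).yield.count (Token.core y) := by
  have h₀ := hT.count_eq _ h.mem_zero
  have h₁ := hT.count_eq _ h.mem_one
  simp only [Ctx.count_yield_plug, Ctx.count_yield_comp] at h₀ h₁ ⊢
  omega

theorem core_mem_iff (hT : IsBalanced c x y T) (h : Pumps c l T C₁ C₂ C₃ C₄ t₅) :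
    Token.core x ∈ (C₂.comp C₄).yield ↔ Token.core y ∈ (C₂.comp C₄).yield := by
  rw [← List.count_pos_iff, h.count_core_eq hT, List.count_pos_iff]

theorem three_mul_bars_le (hT : IsBalanced c x y T) (h : Pumps c l T C₁ C₂ C₃ C₄ t₅) :
    3 * bars (C₂.comp C₄).yield ≤ l := by
  have hopens := (h.pumpsBlocks hT).bars_eq_opens
  have hcloses := (h.pumpsBlocks hT).bars_eq_closes
  have hlen := bars_add_opens_add_closes_le_length (C₂.comp C₄).yield
  have hl := h.length_le
  simp only [Ctx.yield, Ctx.left_comp, Ctx.right_comp, List.length_append, bars_append,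
    opens_append, closes_append] at hl hlen ⊢
  omega

theorem three_mul_abs_surplus_le (hT : IsBalanced c x y T) (h : Pumps c l T C₁ C₂ C₃ C₄ t₅)
    {A : Ctx Δ} (hy : A.yield.count (Token.bar z) ≤ (C₂.comp C₄).yield.count (Token.bar z))
    (hw : A.weight (c (.bar z)) ≤ (C₂.comp C₄).weight (c (.bar z))) :
    3 * |A.surplus c z| ≤ l := by
  have hzero := h.surplus_comp_eq_zero hT (z := z)
  have hbars := h.three_mul_bars_le hT
  have hcount := count_bar_le_bars z (C₂.comp C₄).yield
  have habs : |A.surplus c z| ≤ (C₂.comp C₄).yield.count (Token.bar z) := by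
    unfold Ctx.surplus at hzero ⊢
    exact abs_le.mpr ⟨by omega, by omega⟩
  omega

theorem bar_not_mem_outer (hT : IsBalanced c x y T) (h : Pumps c l T C₁ C₂ C₃ C₄ t₅)
    (hz : Token.core z ∉ (C₂.comp C₄).yield) : Token.bar z ∉ C₂.yield := by
  rw [Ctx.mem_yield_comp, not_or] at hz
  refine fun hb => hz.1 ((List.mem_append.mp hb).elim (fun hb => ?_) fun hb => ?_)
  · exact List.mem_append_left _ ((h.pumpsBlocks hT).core_mem_outer_left hb)
  · exact List.mem_append_right _ ((h.pumpsBlocks hT).core_mem_outer_right hb)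

theorem bar_not_mem_inner (hT : IsBalanced c x y T) (h : Pumps c l T C₁ C₂ C₃ C₄ t₅)
    (hq : Token.core q ∈ t₅.yield) (hz : Token.core z ∉ (C₂.comp C₄).yield) :
    Token.bar z ∉ C₄.yield := by
  rw [Ctx.mem_yield_comp, not_or] at hz
  refine fun hb => hz.2 ((List.mem_append.mp hb).elim (fun hb => ?_) fun hb => ?_)
  · exact List.mem_append_left _
      ((h.pumpsBlocks hT).core_mem_inner_left (List.mem_append_right _ hq) hb)
  · exact List.mem_append_right _
      ((h.pumpsBlocks hT).core_mem_inner_right (List.mem_append_left _ hq) hb)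

/-- Bounds at a cut of `C₁[C₃[t₅]]` carry over to a cut of `C₁[C₂[C₃[C₄[t₅]]]]`: if the pumped
contexts contain an `x`, the bounds are relaxed by `l`; otherwise neither surplus may get worse. -/
theorem step (hT : IsBalanced c x y T) (h : Pumps c l T C₁ C₂ C₃ C₄ t₅)
    {E E' : Ctx Δ} {t t' : Tree Δ}
    (hE : E.plug t = C₁.plug (C₂.plug (C₃.plug (C₄.plug t₅))))
    (hE' : E'.plug t' = C₁.plug (C₃.plug t₅))
    (hb : Token.core y ∉ E'.yield → CutBound c x y l E' t') (hy : Token.core y ∉ E.yield)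
    (hsubset : E'.yield ⊆ E.yield) (hsub : t'.yield.Sublist t.yield)
    (hσ : ∀ z, 3 * |t.surplus c z - t'.surplus c z| ≤ l)
    (hσx : Token.core x ∉ (C₂.comp C₄).yield → t'.surplus c x ≤ t.surplus c x)
    (hσy : Token.core x ∉ (C₂.comp C₄).yield → t.surplus c y ≤ t'.surplus c y ∨
      (-((E.plug t).yield.count (Token.core x) * l : ℤ) ≤ t.surplus c x → CutBound c x y l E t))
    (hdepth : 3 * E'.depth ≤ max (3 * E.depth) l) : CutBound c x y l E t := by
  have hy' : Token.core y ∉ E'.yield := fun hc => hy (hsubset hc)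
  have hb := hb hy'
  have hrun := h.maxRun_le hT y
  obtain ⟨L, hL⟩ := hT.blocks _ h.mem_one
  have hcount (a : Token) : (E.plug t).yield.count a =
      (E'.plug t').yield.count a + (C₂.comp C₄).yield.count a := by
    simp only [hE, hE', Ctx.count_yield_plug, Ctx.count_yield_comp]
    omega
  rw [← hE, ← hE'] at hrun
  rw [← hE] at hL
  have hcx := hcount (.core x)
  by_cases hx : Token.core x ∈ (C₂.comp C₄).yield
  · have := List.count_pos_iff.mpr hx
    exact hb.of_count_lt hL (by omega) hrun hσ hdepth
  · have hcy := hcount (.core y)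
    rw [List.count_eq_zero.mpr hx, add_zero] at hcx
    rw [List.count_eq_zero.mpr (mt (h.core_mem_iff hT).mpr hx), Ctx.count_yield_plug,
      Ctx.count_yield_plug, List.count_eq_zero.mpr hy, List.count_eq_zero.mpr hy'] at hcy
    rcases hσy hx with hσy | hcut
    · exact hb.of_count_eq hcx.symm (by omega) hsub hrun (hσx hx) hσy hdepth
    · exact hcut (hcx ▸ hb.neg_le.trans (hσx hx))

theorem bar_not_mem_inner_left (hT : IsBalanced c x y T) (h : Pumps c l T C₁ C₂ C₃ C₄ t₅)
    (hz : Token.core z ∉ (C₂.comp C₄).yield) (hz₁ : Token.core z ∉ C₁.left) :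
    Token.bar z ∉ C₄.left := by
  simp only [Ctx.yield, Ctx.left_comp, List.mem_append, not_or] at hz
  by_cases hz₃ : Token.core z ∈ C₃.left
  · exact mt ((h.pumpsBlocks hT).core_mem_inner_left (List.mem_append_left _ hz₃)) hz.1.2
  · obtain ⟨L, hL⟩ := hT.blocks _ h.mem_one
    have hL' : blockString L = (C₁.left ++ C₂.left ++ C₃.left ++ C₄.left) ++
        (t₅.yield ++ C₄.right ++ C₃.right ++ C₂.right ++ C₁.right) := by
      simp [hL, Ctx.yield_plug]
    have hbar := bar_not_mem_of_prefix hL' (z := z) (by simp [hz, hz₁, hz₃])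
    exact fun hb => hbar (List.mem_append_right _ hb)

theorem cutBound_of_bar_mem (hT : IsBalanced c x y T) (h : Pumps c l T C₁ C₂ C₃ C₄ t₅)
    {A B : Ctx Δ} (hAB : A.comp B = C₂.comp C₃) (hx : Token.core x ∉ (C₂.comp C₄).yield)
    (hy : Token.core y ∉ (C₁.comp A).yield) (hy₅ : Token.core y ∉ t₅.yield)
    (hbar : Token.bar y ∈ C₄.right)
    (hneg : -(((C₁.comp A).plug (B.plug (C₄.plug t₅))).yield.count (Token.core x) * l : ℤ) ≤
      (B.plug (C₄.plug t₅)).surplus c x) :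
    CutBound c x y l (C₁.comp A) (B.plug (C₄.plug t₅)) := by
  have hP := mt (h.core_mem_iff hT).mpr hx
  have hmem : (C₁.comp A).plug (B.plug (C₄.plug t₅)) ∈ T := by
    rw [Ctx.plug_comp, ← A.plug_comp, hAB, C₂.plug_comp]
    exact h.mem_one
  have hcore := hT.core_mem hmem
  obtain ⟨L, hL⟩ := hT.blocks _ hmem
  have hlen := h.length_le
  rw [← Ctx.comp_assoc, ← hAB] at hlen
  have hr := congrArg (Token.core y ∈ Ctx.right ·) hAB
  simp only [Ctx.mem_yield_plug, Ctx.yield, Ctx.left_comp, Ctx.right_comp, List.mem_append,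
    not_or, eq_iff_iff] at hP hcore hy hr
  have hyr : Token.core y ∉ C₃.right := fun hy₃ => hP.2.1
    ((h.pumpsBlocks hT).core_mem_inner_right (List.mem_append_right _ hy₃) hbar)
  obtain ⟨u, m, hum, hm⟩ := exists_last_eq (u := B.left) (a := Token.core y) (by tauto)
  obtain ⟨d, e, hde⟩ := List.append_of_mem hbar
  simp only [hde, List.mem_append, List.mem_cons, not_or] at hP
  simp only [Ctx.yield, Ctx.left_comp, Ctx.right_comp, hum, hde, List.length_append,
    List.length_cons] at hlen
  refine CutBound.of_tail hL (hT.pos _ hmem) hneg (u := u)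
    (m := m ++ C₄.left ++ t₅.yield ++ d) (v := e ++ B.right) ?_ ?_ ?_ ?_
  · simp [Ctx.yield_plug, hum, hde]
  · simp [hm, hP, hy₅]
  · have : Token.core y ∉ B.right := by tauto
    simp [hP, this]
  · rw [List.length_append]
    omega

theorem bar_not_mem_or_cutBound (hT : IsBalanced c x y T) (h : Pumps c l T C₁ C₂ C₃ C₄ t₅)
    {A B : Ctx Δ} (hAB : A.comp B = C₂.comp C₃) (hx : Token.core x ∉ (C₂.comp C₄).yield)
    (hy : Token.core y ∉ (C₁.comp A).yield) : Token.bar y ∉ C₄.yield ∨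
      (-(((C₁.comp A).plug (B.plug (C₄.plug t₅))).yield.count (Token.core x) * l : ℤ) ≤
        (B.plug (C₄.plug t₅)).surplus c x →
      CutBound c x y l (C₁.comp A) (B.plug (C₄.plug t₅))) := by
  have hP := mt (h.core_mem_iff hT).mpr hx
  by_cases hy₅ : Token.core y ∈ t₅.yield
  · exact Or.inl (h.bar_not_mem_inner hT hy₅ hP)
  by_cases hbar : Token.bar y ∈ C₄.right
  · exact Or.inr (h.cutBound_of_bar_mem hT hAB hx hy hy₅ hbar)
  · have hy₁ : Token.core y ∉ C₁.left := fun hc => hy (by simp [Ctx.yield, Ctx.left_comp, hc])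
    exact Or.inl (List.mem_append.not.mpr
      (not_or.mpr ⟨h.bar_not_mem_inner_left hT hP hy₁, hbar⟩))

end Pumps

end Pumping

/-! ## Induction on cuts -/

theorem closes_le_of_bars_pos {L : List (Letter × ℕ)} {u v w : List Token}
    (h : blockString L = u ++ v ++ w) (hv : ∀ z, Token.bar z ∈ v → Token.core z ∈ v)
    (hpos : 0 < bars v) : closes w ≤ bars w + bars v := by
  obtain ⟨z, hz⟩ := exists_bar_mem_of_bars_pos hpos
  exact closes_le_of_core_mem h (hv z hz)

section Cuts

variable {Δ : Signature} {c : Sym → Δ.Op → ℕ} {x y q : Letter} {l : ℕ}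

namespace Pumps

variable {T : Set (Tree Δ)} {C₁ C₂ C₃ C₄ : Ctx Δ} {t₅ t : Tree Δ}

theorem cutBound_above (hT : IsBalanced c x y T) {E F : Ctx Δ}
    (h : Pumps c l T (E.comp F) C₂ C₃ C₄ t₅)
    (hb : Token.core y ∉ E.yield → CutBound c x y l E (F.plug (C₃.plug t₅)))
    (hy : Token.core y ∉ E.yield) :
    CutBound c x y l E (F.plug (C₂.plug (C₃.plug (C₄.plug t₅)))) := by
  have hσ (z : Letter) : (F.plug (C₂.plug (C₃.plug (C₄.plug t₅)))).surplus c z =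
      (F.plug (C₃.plug t₅)).surplus c z := by
    have hP := h.surplus_comp_eq_zero hT (z := z)
    simp only [Ctx.surplus_plug, Ctx.surplus_comp] at hP ⊢
    omega
  have hsub : (C₃.plug t₅).yield.Sublist (C₂.plug (C₃.plug (C₄.plug t₅))).yield :=
    (C₃.yield_plug_sublist (C₄.yield_sublist_plug t₅)).trans (C₂.yield_sublist_plug _)
  exact h.step hT (Ctx.plug_comp _ _ _).symm (Ctx.plug_comp _ _ _).symm hb hy
    (List.Subset.refl _) (F.yield_plug_sublist hsub) (fun z => by simp [hσ])
    (fun _ => (hσ x).ge) (fun _ => Or.inl (hσ y).le) (le_max_left _ _)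

theorem cutBound_beside (hT : IsBalanced c x y T) (h : Pumps c l T C₁ C₂ C₃ C₄ t₅)
    {K : Tree Δ → Ctx Δ} (hK : C₁.Beside t K)
    (hb : Token.core y ∉ (K (C₃.plug t₅)).yield → CutBound c x y l (K (C₃.plug t₅)) t)
    (hy : Token.core y ∉ (K (C₂.plug (C₃.plug (C₄.plug t₅)))).yield) :
    CutBound c x y l (K (C₂.plug (C₃.plug (C₄.plug t₅)))) t := by
  have hbal := (h.pumpsBlocks hT).bars_eq_closes
  have hdepth :
      (K (C₃.plug t₅)).depth = (K (C₂.plug (C₃.plug (C₄.plug t₅)))).depth := by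
    unfold Ctx.depth
    rcases hK.left_right_eq with ⟨α, β, γ, hs⟩ | ⟨α, β, γ, hs⟩
    · simp only [hs, Ctx.yield_plug, closes_append, bars_append]
      omega
    · simp only [hs]
  have hsubset :
      (K (C₃.plug t₅)).yield ⊆ (K (C₂.plug (C₃.plug (C₄.plug t₅)))).yield := by
    intro a
    rcases hK.left_right_eq with ⟨α, β, γ, hs⟩ | ⟨α, β, γ, hs⟩ <;>
    · simp only [Ctx.yield, hs, Ctx.yield_plug, List.mem_append]
      tauto
  exact h.step hT (hK.plug_eq _) (hK.plug_eq _) hb hy hsubset (List.Sublist.refl _) (by simp)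
    (fun _ => le_rfl) (fun _ => Or.inl le_rfl) (hdepth ▸ le_max_left _ _)

theorem cutBound_below (hT : IsBalanced c x y T) {F : Ctx Δ}
    (h : Pumps c l T C₁ C₂ C₃ C₄ (F.plug t))
    (hb : Token.core y ∉ (C₁.comp (C₃.comp F)).yield → CutBound c x y l (C₁.comp (C₃.comp F)) t)
    (hy : Token.core y ∉ (C₁.comp (C₂.comp (C₃.comp (C₄.comp F)))).yield) :
    CutBound c x y l (C₁.comp (C₂.comp (C₃.comp (C₄.comp F)))) t := by
  have hright := (h.pumpsBlocks hT).bars_right_le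
  have hsubset :
      (C₁.comp (C₃.comp F)).yield ⊆ (C₁.comp (C₂.comp (C₃.comp (C₄.comp F)))).yield := by
    intro a
    simp only [Ctx.mem_yield_comp]
    tauto
  refine h.step hT (by simp only [Ctx.plug_comp]) (by simp only [Ctx.plug_comp]) hb hy hsubset
    (List.Sublist.refl _) (by simp) (fun _ => le_rfl) (fun _ => Or.inl le_rfl) ?_
  simp only [Ctx.depth, Ctx.right_comp, closes_append, bars_append]
  omega

theorem three_mul_depth_outer_le (hT : IsBalanced c x y T) {A B : Ctx Δ}
    (h : Pumps c l T C₁ (A.comp B) C₃ C₄ t₅) : 3 * C₁.depth ≤ max (3 * (C₁.comp A).depth) l := by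
  have hP := h.three_mul_bars_le hT
  obtain ⟨L, hL⟩ := hT.blocks _ h.mem_one
  have hclose := closes_le_of_bars_pos (L := L) (v := (A.comp B).right) (w := C₁.right)
    (by rw [hL, Ctx.yield_plug, Ctx.yield_plug, ← List.append_assoc, ← List.append_assoc])
    fun z => (h.pumpsBlocks hT).core_mem_outer_right
  simp only [Ctx.yield, Ctx.left_comp, Ctx.right_comp, bars_append] at hP hclose
  simp only [Ctx.depth, Ctx.right_comp, closes_append, bars_append]
  omega

theorem cutBound_outer (hT : IsBalanced c x y T) {A B : Ctx Δ}
    (h : Pumps c l T C₁ (A.comp B) C₃ C₄ t₅)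
    (hb : Token.core y ∉ C₁.yield → CutBound c x y l C₁ (C₃.plug t₅))
    (hy : Token.core y ∉ (C₁.comp A).yield) :
    CutBound c x y l (C₁.comp A) (B.plug (C₃.plug (C₄.plug t₅))) := by
  have hσ (z : Letter) : (B.plug (C₃.plug (C₄.plug t₅))).surplus c z =
      (C₃.plug t₅).surplus c z - A.surplus c z := by
    have hP := h.surplus_comp_eq_zero hT (z := z)
    simp only [Ctx.surplus_plug, Ctx.surplus_comp] at hP ⊢
    omega
  have hsubset : C₁.yield ⊆ (C₁.comp A).yield :=
    fun _ ha => Ctx.mem_yield_comp.mpr (Or.inl ha)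
  have hcut : _ → Token.bar y ∉ C₄.yield ∨ _ := fun hx =>
    (Ctx.plug_comp B C₃ _) ▸ h.bar_not_mem_or_cutBound hT (Ctx.comp_assoc _ _ _).symm hx hy
  refine h.step hT (by simp only [Ctx.plug_comp]) rfl hb hy hsubset
    ((C₃.yield_plug_sublist (C₄.yield_sublist_plug t₅)).trans (B.yield_sublist_plug _))
    (fun z => ?_) (fun hx => ?_) (fun hx => (hcut hx).imp_left fun hC₄ => ?_)
    (h.three_mul_depth_outer_le hT)
  · rw [hσ, sub_sub_cancel_left, abs_neg]
    exact h.three_mul_abs_surplus_le hT (by grind [Ctx.count_yield_comp])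
      (by grind [Ctx.weight_comp])
  · have hA := h.bar_not_mem_outer hT hx
    rw [Ctx.mem_yield_comp, not_or] at hA
    have := Ctx.surplus_nonpos (c := c) hA.1
    rw [hσ]
    omega
  · have hB := h.bar_not_mem_outer hT (mt (h.core_mem_iff hT).mpr hx)
    rw [Ctx.mem_yield_comp, not_or] at hB
    have hσB := Ctx.surplus_nonpos (c := c) hB.2
    have hσC₄ := Ctx.surplus_nonpos (c := c) hC₄
    simp only [Ctx.surplus_plug]
    omega

theorem cutBound_middle (hT : IsBalanced c x y T) {A B : Ctx Δ}
    (h : Pumps c l T C₁ C₂ (A.comp B) C₄ t₅)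
    (hb : Token.core y ∉ (C₁.comp A).yield → CutBound c x y l (C₁.comp A) (B.plug t₅))
    (hy : Token.core y ∉ (C₁.comp (C₂.comp A)).yield) :
    CutBound c x y l (C₁.comp (C₂.comp A)) (B.plug (C₄.plug t₅)) := by
  have hσ (z : Letter) : (B.plug (C₄.plug t₅)).surplus c z =
      (B.plug t₅).surplus c z - C₂.surplus c z := by
    have hP := h.surplus_comp_eq_zero hT (z := z)
    simp only [Ctx.surplus_plug, Ctx.surplus_comp] at hP ⊢
    omega
  have hright := (h.pumpsBlocks hT).bars_outer_right_le
  have hsubset : (C₁.comp A).yield ⊆ (C₁.comp (C₂.comp A)).yield := by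
    intro a
    simp only [Ctx.mem_yield_comp]
    tauto
  refine h.step hT (by simp only [Ctx.plug_comp]) (by simp only [Ctx.plug_comp]) hb hy hsubset
    (B.yield_plug_sublist (C₄.yield_sublist_plug t₅)) (fun z => ?_) (fun hx => ?_)
    (fun hx => (h.bar_not_mem_or_cutBound hT (Ctx.comp_assoc _ _ _) hx hy).imp_left
      fun hC₄ => ?_) ?_
  · rw [hσ, sub_sub_cancel_left, abs_neg]
    exact h.three_mul_abs_surplus_le hT (by grind [Ctx.count_yield_comp])
      (by grind [Ctx.weight_comp])
  · have := Ctx.surplus_nonpos (c := c) (h.bar_not_mem_outer hT hx)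
    rw [hσ]
    omega
  · have := Ctx.surplus_nonpos (c := c) hC₄
    simp only [Ctx.surplus_plug]
    omega
  · simp only [Ctx.depth, Ctx.right_comp, closes_append, bars_append]
    omega

theorem three_mul_depth_inner_le (hT : IsBalanced c x y T) {A B : Ctx Δ}
    (h : Pumps c l T C₁ C₂ C₃ (A.comp B) t₅) (hq : Token.core q ∈ t₅.yield) :
    3 * (C₁.comp C₃).depth ≤ max (3 * (C₁.comp (C₂.comp (C₃.comp A))).depth) l := by
  have hright := (h.pumpsBlocks hT).bars_outer_right_le
  have hP := h.three_mul_bars_le hT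
  obtain ⟨L, hL⟩ := hT.blocks _ h.mem_one
  have hclose := closes_le_of_bars_pos (L := L) (v := (A.comp B).right)
    (u := C₁.left ++ C₂.left ++ C₃.left ++ (A.comp B).left ++ t₅.yield)
    (w := C₃.right ++ C₂.right ++ C₁.right) (by simp [hL, Ctx.yield_plug])
    fun z => (h.pumpsBlocks hT).core_mem_inner_right (List.mem_append_left _ hq)
  simp only [Ctx.yield, Ctx.left_comp, Ctx.right_comp, bars_append, closes_append]
    at hP hclose
  simp only [Ctx.depth, Ctx.right_comp, closes_append, bars_append]
  omega

theorem cutBound_inner (hT : IsBalanced c x y T) {A B : Ctx Δ}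
    (h : Pumps c l T C₁ C₂ C₃ (A.comp B) t₅)
    (hb : Token.core y ∉ (C₁.comp C₃).yield → CutBound c x y l (C₁.comp C₃) t₅)
    (hy : Token.core y ∉ (C₁.comp (C₂.comp (C₃.comp A))).yield) :
    CutBound c x y l (C₁.comp (C₂.comp (C₃.comp A))) (B.plug t₅) := by
  have hsubset : (C₁.comp C₃).yield ⊆ (C₁.comp (C₂.comp (C₃.comp A))).yield := by
    intro a
    simp only [Ctx.mem_yield_comp]
    tauto
  have hy₅ : Token.core y ∈ t₅.yield := by
    have hcore := hT.core_mem h.mem_zero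
    rw [← Ctx.plug_comp, Ctx.mem_yield_plug] at hcore
    exact hcore.resolve_left fun hc => hy (hsubset hc)
  refine h.step hT (by simp only [Ctx.plug_comp]) (by simp only [Ctx.plug_comp]) hb hy hsubset
    (B.yield_sublist_plug t₅) (fun z => ?_) (fun hx => ?_) (fun hx => Or.inl ?_)
    (h.three_mul_depth_inner_le hT hy₅)
  · rw [Ctx.surplus_plug, add_sub_cancel_right]
    exact h.three_mul_abs_surplus_le hT (by grind [Ctx.count_yield_comp])
      (by grind [Ctx.weight_comp])
  · have hσ := h.surplus_comp_eq_zero hT (z := x)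
    have hσC₂ := Ctx.surplus_nonpos (c := c) (h.bar_not_mem_outer hT hx)
    have hC₄ := h.bar_not_mem_inner hT hy₅ hx
    rw [Ctx.mem_yield_comp, not_or] at hC₄
    have hσA := Ctx.surplus_nonpos (c := c) hC₄.1
    simp only [Ctx.surplus_plug, Ctx.surplus_comp] at hσ ⊢
    omega
  · have hC₄ := h.bar_not_mem_inner hT hy₅ (mt (h.core_mem_iff hT).mpr hx)
    rw [Ctx.mem_yield_comp, not_or] at hC₄
    have hσB := Ctx.surplus_nonpos (c := c) hC₄.2
    rw [Ctx.surplus_plug]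
    omega

theorem cutBound_of_beside {C E : Ctx Δ} (hpos : 0 < (E.plug t).yield.count (Token.core x))
    {K : Tree Δ → Ctx Δ} (hK : C.Beside t K) (hlen : C.yield.length ≤ l)
    (hw : ∀ z, C.weight (c z) ≤ l) : CutBound c x y l E t := by
  have hcount : t.yield.count (Token.bar y) ≤ t.yield.length := List.count_le_length
  have hlen' := hK.length_yield_le
  have hweight := (hK.weight_le (c (.bar x))).trans (hw _)
  exact CutBound.of_le hpos (by unfold Tree.surplus; omega) (by unfold Tree.surplus; omega)

theorem cutBound (hT : IsBalanced c x y T) (h : Pumps c l T C₁ C₂ C₃ C₄ t₅)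
    (ih : ∀ E t, E.plug t = C₁.plug (C₃.plug t₅) → Token.core y ∉ E.yield →
      CutBound c x y l E t) {E : Ctx Δ}
    (hE : C₁.plug (C₂.plug (C₃.plug (C₄.plug t₅))) = E.plug t) (hy : Token.core y ∉ E.yield) :
    CutBound c x y l E t := by
  have hpos := hE ▸ hT.pos _ h.mem_one
  have hlen := h.length_le
  have hw := h.weight_le
  simp only [Ctx.length_yield_comp] at hlen
  simp only [Ctx.weight_comp] at hw
  rcases C₁.compare E _ _ hE with ⟨F, rfl, rfl⟩ | ⟨F, rfl, hF₂⟩ | ⟨K, rfl, hK⟩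
  · exact h.cutBound_above hT (ih _ _ (by simp only [Ctx.plug_comp])) hy
  · rcases C₂.compare F _ _ hF₂ with ⟨B, rfl, rfl⟩ | ⟨F, rfl, hF₃⟩ | ⟨K, rfl, hK⟩
    · exact h.cutBound_outer hT (ih _ _ rfl) hy
    · rcases C₃.compare F _ _ hF₃ with ⟨B, rfl, rfl⟩ | ⟨F, rfl, hF₄⟩ | ⟨K, rfl, hK⟩
      · exact h.cutBound_middle hT (ih _ _ (by simp only [Ctx.plug_comp])) hy
      · rcases C₄.compare F _ _ hF₄ with ⟨B, rfl, rfl⟩ | ⟨F, rfl, rfl⟩ | ⟨K, rfl, hK⟩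
        · exact h.cutBound_inner hT (ih _ _ (by simp only [Ctx.plug_comp])) hy
        · exact h.cutBound_below hT (ih _ _ (by simp only [Ctx.plug_comp])) hy
        · exact cutBound_of_beside hpos hK (by omega) fun z => by have := hw z; omega
      · exact cutBound_of_beside hpos hK (by omega) fun z => by have := hw z; omega
    · exact cutBound_of_beside hpos hK (by omega) fun z => by have := hw z; omega
  · exact h.cutBound_beside hT hK (ih _ _ (hK.plug_eq _)) hy

end Pumps

theorem IsBalanced.cutBound_of_le {T : Set (Tree Δ)} (hT : IsBalanced c x y T) {E : Ctx Δ}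
    {t : Tree Δ} (ht : E.plug t ∈ T) (hlen : E.yield.length ≤ l)
    (hw : ∀ z, E.weight (c z) ≤ l) : CutBound c x y l E t := by
  have hx := hT.surplus_eq_zero ht (z := x)
  have hy := hT.surplus_eq_zero ht (z := y)
  have hcount : E.yield.count (Token.bar x) ≤ E.yield.length := List.count_le_length
  have hweight := hw (.bar y)
  rw [Ctx.surplus_plug, Ctx.surplus] at hx hy
  exact CutBound.of_le (hT.pos _ ht) (by omega) (by omega)

theorem IsBalanced.cutBound {T : Set (Tree Δ)} (hT : IsBalanced c x y T) {p : ℕ}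
    (hp : IsPumpingHeight T p) (hlen : ∀ C : Ctx Δ, C.height ≤ p → C.yield.length ≤ l)
    (hw : ∀ C : Ctx Δ, C.height ≤ p → ∀ z, C.weight (c z) ≤ l) {E : Ctx Δ} {t : Tree Δ}
    (ht : E.plug t ∈ T) (hy : Token.core y ∉ E.yield) : CutBound c x y l E t := by
  induction hN : (E.plug t).weight (fun _ => 1) using Nat.strong_induction_on generalizing E t with
  | _ N ih =>
  rcases le_or_gt (E.plug t).height p with hheight | hheight
  · have hE := (E.height_le_plug t).trans hheight
    exact hT.cutBound_of_le ht (hlen E hE) (hw E hE)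
  · obtain ⟨C₁, C₂, C₃, C₄, t₅, hdec⟩ := hp _ ht hheight
    have h : Pumps c l T C₁ C₂ C₃ C₄ t₅ :=
      ⟨hdec.mem, hlen _ hdec.height_le, hw _ hdec.height_le⟩
    refine h.cutBound hT (fun E' t' hE' hy' => ?_) hdec.eq.symm hy
    refine ih _ ?_ (hE' ▸ h.mem_zero) hy' rfl
    have hpos : 0 < C₂.weight (fun _ => 1) + C₄.weight (fun _ => 1) :=
      (Nat.add_pos_iff_pos_or_pos.mp hdec.height_pos).elim
        (fun h₂ => Nat.add_pos_left (Ctx.weight_pos h₂) _)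
        fun h₄ => Nat.add_pos_right _ (Ctx.weight_pos h₄)
    rw [← hN, hE', hdec.eq]
    simp only [Ctx.weight_plug]
    omega

end Cuts

/-! ## Asynchrony -/

section Asynchrony

variable {Δ : Signature} {x y : Letter} {l : ℕ}

theorem Graph.Iso.refl {Λ : Type} (g : Graph Λ) : g.Iso g :=
  ⟨Equiv.refl _, Equiv.refl _, fun _ => ⟨rfl, rfl, rfl⟩⟩

theorem isBalanced_of_isCSD {Λ : Type} {k : ℕ} {G : LMCFTG Δ} {h : Hom Δ Λ k}
    (hR : IsCSD (REL G h)) (hxy : Sep x y) : IsBalanced h.edges x y G.language := by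
  have hmem (t) (ht : t ∈ G.language) : (t.yield, (h.graph t).toGraph) ∈ REL G h :=
    ⟨t, ht, rfl, Graph.Iso.refl _⟩
  have hCSDs (t) (ht : t ∈ G.language) : t.yield ∈ CSDs := (hR.strings _).mp ⟨_, hmem t ht⟩
  exact
    { blocks := fun t ht => exists_blockString (hCSDs t ht)
      weight_eq := fun t ht z =>
        (h.edgeCount_graph _ t).symm.trans (hR.edges _ _ (hmem t ht) (.bar z))
      count_eq := fun t ht => (count_core_of_mem (hCSDs t ht) hxy).1
      pos := fun t ht => (count_core_of_mem (hCSDs t ht) hxy).2 }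

theorem Separated.exists_isMinimalSeparation {t : Tree Δ} (ht : Separated x y l t) :
    ∃ Dx D₀ ty, IsMinimalSeparation x y l t Dx D₀ ty := by
  classical
  have hex : ∃ n Dx D₀ ty, IsSeparation x y l t Dx D₀ ty ∧ D₀.height = n := by
    obtain ⟨Dx, D₀, ty, h⟩ := ht
    exact ⟨_, Dx, D₀, ty, h, rfl⟩
  obtain ⟨Dx, D₀, ty, h, hn⟩ := Nat.find_spec hex
  exact ⟨Dx, D₀, ty, h, fun Ex E₀ sy h' => hn ▸ Nat.find_min' hex ⟨Ex, E₀, sy, h', rfl⟩⟩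

theorem IsSeparation.count_bar_le {L : List (Letter × ℕ)} {t ty : Tree Δ} {Dx D₀ : Ctx Δ}
    (hs : IsSeparation x y l t Dx D₀ ty) (hL : blockString L = t.yield) :
    (D₀.plug ty).yield.count (Token.bar x) ≤ maxRun (Token.bar x) t.yield * (l + 1) := by
  have hcore : (D₀.plug ty).yield.count (Token.core x) ≤ l := by
    rw [Ctx.count_yield_plug, hs.inner]
    exact hs.middle
  have hsplit : blockString L = Dx.left ++ (D₀.plug ty).yield ++ Dx.right := by
    rw [hL, hs.eq, Ctx.yield_plug]
  refine (count_bar_le_mul_maxRun hsplit).trans ?_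
  rw [hL, mul_comm]
  exact Nat.mul_le_mul_left _ (by omega)

theorem CutBound.count_bar_le {c : Sym → Δ.Op → ℕ} {L : List (Letter × ℕ)} {E : Ctx Δ}
    {t : Tree Δ} (hb : CutBound c x y l E t) (hL : blockString L = (E.plug t).yield)
    (hE : Token.core y ∉ E.yield) (hy : Token.core y ∈ (E.plug t).yield) :
    (E.plug t).yield.count (Token.bar y) ≤ t.weight (c (.bar y)) +
      (E.plug t).yield.count (Token.core x) * l + maxRun (Token.bar y) (E.plug t).yield := by
  have hrun := hb.le_run
  have hlast := hb.le_last
  have hyt : Token.core y ∈ t.yield := (Ctx.mem_yield_plug.mp hy).resolve_left hE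
  obtain ⟨u, v, huv, hv⟩ := exists_last_eq hyt
  obtain ⟨hEl, hEr⟩ : Token.core y ∉ E.left ∧ Token.core y ∉ E.right := by
    simpa [Ctx.yield] using hE
  have hsplit : blockString L = (E.left ++ u) ++ Token.core y :: (v ++ E.right) := by
    simp [hL, Ctx.yield_plug, huv]
  have hleft : Token.bar y ∉ E.left :=
    bar_not_mem_of_prefix (hsplit.trans (List.append_assoc _ _ _)) hEl
  have hcount : (E.plug t).yield.count (Token.bar y) =
      t.yield.count (Token.bar y) + E.right.count (Token.bar y) := by
    rw [Ctx.count_yield_plug, Ctx.yield, List.count_append, List.count_eq_zero.mpr hleft]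
    omega
  rw [Tree.surplus] at hrun hlast
  by_cases hcl : Coreless v
  · have hafter : v.count (Token.bar y) + E.right.count (Token.bar y) ≤
        maxRun (Token.bar y) (E.plug t).yield := by
      rw [← List.count_append, ← hL]
      exact count_bar_le_maxRun (w := []) (u := E.left ++ u ++ [Token.core y])
        (by simp [hsplit]) (by simp [hv, hEr])
    have := hlast u v huv hcl
    omega
  · obtain ⟨v₁, q, v₂, rfl, -⟩ := exists_last_core hcl
    simp only [List.mem_append, List.mem_cons, not_or] at hv
    have hqy : q ≠ y := fun h => hv.2.1 (h ▸ rfl)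
    have hright : Token.bar y ∉ v₂ ++ E.right :=
      bar_not_mem_after_core (L := L) (u := E.left ++ u ++ Token.core y :: v₁) (q := q)
        (by simp [hsplit]) (by simp [hv, hEr]) hqy
    rw [List.mem_append, not_or] at hright
    rw [List.count_eq_zero.mpr hright.2] at hcount
    omega

theorem asynchronous_of_separated {Λ : Type} {k : ℕ} {h : Hom Δ Λ k} {T : Set (Tree Δ)}
    (hT : IsBalanced h.edges x y T) {p : ℕ} (hp : IsPumpingHeight T p)
    (hl : IsGenerationBound h p l) {t : Tree Δ} (ht : t ∈ T) (hsep : Separated x y l t) :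
    Asynchronous h x y l t := by
  obtain ⟨Dx, D₀, ty, hmin⟩ := hsep.exists_isMinimalSeparation
  refine ⟨Dx, D₀, ty, hmin, ?_⟩
  obtain ⟨L, hL⟩ := hT.blocks t ht
  have houter : Token.core y ∉ Dx.yield := List.count_eq_zero.mp hmin.1.outer
  have hx := hmin.1.count_bar_le hL
  obtain rfl := hmin.1.eq
  have hb : CutBound h.edges x y l Dx (D₀.plug ty) :=
    hT.cutBound hp (fun C hC => (hl C hC).1)
      (fun C hC z => (h.weight_edges_le_size C z).trans (hl C hC).2) ht houter
  have hneg := hb.neg_le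
  have hy := hb.count_bar_le hL houter (hT.core_mem ht)
  rw [Tree.surplus] at hneg
  rw [h.edgeCount_graph, h.edgeCount_graph]
  exact ⟨by omega, by omega⟩

end Asynchrony

end SemCap

theorem lemma8_general {Δ : SemCap.Signature} {Λ : Type} {k : ℕ} (G : SemCap.LMCFTG Δ)
    (h : SemCap.Hom Δ Λ k) :
    (∃ p : ℕ, SemCap.IsPumpingHeight G.language p) ∧
      ∀ p : ℕ, SemCap.IsPumpingHeight G.language p →
        (∃ l₀ : ℕ, SemCap.IsGenerationBound h p l₀) ∧
          ∀ l₀ : ℕ, SemCap.IsGenerationBound h p l₀ →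
            ∀ x y : SemCap.Letter, SemCap.IsBalanced h.edges x y G.language →
              ∀ t ∈ G.language, SemCap.Separated x y l₀ t →
                SemCap.Asynchronous h x y l₀ t :=
  ⟨G.exists_isPumpingHeight, fun p hp => ⟨SemCap.exists_isGenerationBound h p,
    fun _ hl _ _ hT _ ht hsep => SemCap.asynchronous_of_separated hT hp hl ht hsep⟩⟩

theorem lemma8 {Δ : SemCap.Signature} {Λ : Type} {k : ℕ}
    (G : SemCap.LMCFTG Δ) (h : SemCap.Hom Δ Λ k)
    (CSD : Set (List SemCap.Token × SemCap.Graph Λ)) (hCSD : SemCap.IsCSD CSD)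
    (hREL : CSD = SemCap.REL G h) :
    (∃ p : ℕ, SemCap.IsPumpingHeight G.language p) ∧
      ∀ p : ℕ, SemCap.IsPumpingHeight G.language p →
        (∃ l₀ : ℕ, SemCap.IsGenerationBound h p l₀) ∧
          ∀ l₀ : ℕ, SemCap.IsGenerationBound h p l₀ →
            ∀ x y : SemCap.Letter, SemCap.Sep x y →
              ∀ t ∈ G.language, SemCap.Separated x y l₀ t →
                SemCap.Asynchronous h x y l₀ t := by
  obtain ⟨hp, hl⟩ := lemma8_general G h
  refine ⟨hp, fun p hp => (hl p hp).imp_right fun hsep l₀ hl₀ x y hxy => ?_⟩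
  exact hsep l₀ hl₀ x y (SemCap.isBalanced_of_isCSD (hREL ▸ hCSD) hxy)
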